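/- Let $G$ be a second countable locally compact Hausdorff groupoid with a continuous Haar system, with unit space $G^{(0)}$ and range and source maps $r,s$, and let $H\subseteq G$ be a closed subgroupoid with a continuous Haar system. Put $X=s^{-1}(H^{(0)})$, on which $H$ acts on the right by multiplication, let $X/H$ be the orbit space with the quotient topology, and let $\rho:X/H\to G^{(0)}$ be the continuous map $\rho([\gamma])=r(\gamma)$. Let $(\mathscr A,G,\alpha)$ be a separable groupoid dynamical system: $A$ is a separable $C_0(G^{(0)})$-algebra with associated upper semicontinuous $C^*$-bundle $\mathscr A\to G^{(0)}$, and $\alpha$ is a continuous action of $G$ on $\mathscr A$ by $*$-isomorphisms $\alpha_\gamma:\mathscr A_{s(\gamma)}\to\mathscr A_{r(\gamma)}$. Let $I$ be a closed two-sided ideal of $A$ that is $G$-invariant, i.e. $\alpha_\gamma(\mathscr I_{s(\gamma)})=\mathscr I_{r(\gamma)}$ for all $\gamma\in G$, where $\mathscr I$ is the bundle of the $C_0(G^{(0)})$-algebra $I$ and $\mathscr I_u$ is regarded as an ideal of $\mathscr A_u$. Let $\iota:I\to A$ be the inclusion and $q:A\to A/I$ the quotient map, where $I$ and $A/I$ carry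 the induced $C_0(G^{(0)})$-algebra structures. For a $C_0(G^{(0)})$-algebra $B$ with associated bundle $\mathscr B$, let $\rho^*B=\Gamma_0(X/H,\rho^*\mathscr B)$ be the $C^*$-algebra of continuous sections vanishing at infinity of the pullback bundle $\rho^*\mathscr B=\{(y,b)\in X/H\times\mathscr B: b\in\mathscr B_{\rho(y)}\}$, on which $C_0(X/H)$ acts by pointwise multiplication. For a $C_0(G^{(0)})$-linear $*$-homomorphism $\psi:B\to C$ with induced maps on fibres $\psi_u:\mathscr B_u\to\mathscr C_u$, let $\rho^*\psi:\rho^*B\to\rho^*C$ be the $*$-homomorphism $(\rho^*\psi)(f)(y)=\psi_{\rho(y)}(f(y))$. Then $\rho^*I$, $\rho^*A$ and $\rho^*(A/I)$ are $C_0(X/H)$-algebras, the maps $\rho^*\iota$ and $\rho^*q$ are $C_0(X/H)$-linear, and the sequence $$0\longrightarrow \rho^*I\xrightarrow{\ \rho^*\iota\ }\rho^*A\xrightarrow{\ \rho^*q\ }\rho^*(A/I)\longrightarrow 0$$ is exact: $\rho^*\iota$ is injective, the range of $\rho^*\iota$ is the kernel of $\rho^*q$, and $\rho^*q$ is surjective.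 -/

import Mathlib

open scoped ZeroAtInfty MultiplierAlgebra ENNReal Topology

noncomputable section

namespace PullbackExact

/-- A closed two-sided ideal of a C⋆-algebra. -/
structure ClosedIdeal (B : Type*) [NonUnitalCStarAlgebra B] extends Submodule ℂ B where
  mul_mem_left' : ∀ (b : B) {a : B}, a ∈ carrier → b * a ∈ carrier
  mul_mem_right' : ∀ (b : B) {a : B}, a ∈ carrier → a * b ∈ carrier
  isClosed' : IsClosed carrier

namespace ClosedIdeal

variable {B : Type*} [NonUnitalCStarAlgebra B]

instance : SetLike (ClosedIdeal B) B where
  coe J := J.carrier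
  coe_injective := by
    rintro ⟨J, _, _, _⟩ ⟨K, _, _, _⟩ h
    congr
    exact SetLike.coe_injective h

theorem mul_mem_left (J : ClosedIdeal B) (b : B) {a : B} (ha : a ∈ J) : b * a ∈ J :=
  J.mul_mem_left' b ha

theorem mul_mem_right (J : ClosedIdeal B) (b : B) {a : B} (ha : a ∈ J) : a * b ∈ J :=
  J.mul_mem_right' b ha

theorem isClosed (J : ClosedIdeal B) : IsClosed (J : Set B) := J.isClosed'

instance : NonUnitalSubringClass (ClosedIdeal B) B where
  add_mem {J} _ _ := J.add_mem'
  zero_mem J := J.zero_mem'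
  neg_mem {J} _ h := J.toSubmodule.neg_mem h
  mul_mem {J} _ _ _ h := J.mul_mem_left _ h

instance : SMulMemClass (ClosedIdeal B) ℂ B where
  smul_mem {J} c _ h := J.smul_mem' c h

/-- The part `J ∩ J⋆` of an ideal, as a C⋆-subalgebra. -/
def starPart (J : ClosedIdeal B) : NonUnitalStarSubalgebra ℂ B where
  carrier := {a | a ∈ J ∧ star a ∈ J}
  add_mem' h k := ⟨add_mem h.1 k.1, by rw [star_add]; exact add_mem h.2 k.2⟩
  zero_mem' := ⟨zero_mem J, by rw [star_zero]; exact zero_mem J⟩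
  mul_mem' h k := ⟨mul_mem h.1 k.1, by rw [star_mul]; exact mul_mem k.2 h.2⟩
  smul_mem' c _ h := ⟨SMulMemClass.smul_mem c h.1, by
    rw [star_smul]; exact SMulMemClass.smul_mem _ h.2⟩
  star_mem' h := ⟨h.2, by rw [star_star]; exact h.1⟩

theorem isClosed_starPart (J : ClosedIdeal B) : IsClosed (J.starPart : Set B) :=
  J.isClosed.inter (J.isClosed.preimage continuous_star)

/-- Approximate units inside an ideal. -/
theorem exists_approx (J : ClosedIdeal B) {j : B} (hj : j ∈ J) {ε : ℝ} (hε : 0 < ε) :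
    ∃ e ∈ J, star e = e ∧ (∀ b : B, ‖b - e * b‖ ≤ ‖b‖) ∧ ‖j - j * e‖ < ε := by
  have := J.isClosed_starPart
  let _ : PartialOrder J.starPart := CStarAlgebra.spectralOrder _
  have : StarOrderedRing J.starPart := CStarAlgebra.spectralOrderedRing _
  let _ : PartialOrder B := CStarAlgebra.spectralOrder _
  have : StarOrderedRing B := CStarAlgebra.spectralOrderedRing _
  have hh : star j * j ∈ J.starPart :=
    ⟨J.mul_mem_left _ hj, by rw [star_mul, star_star]; exact J.mul_mem_left _ hj⟩
  have H := CStarAlgebra.increasingApproximateUnit J.starPart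
  have hlim := H.tendsto_mul_left ⟨_, hh⟩
  have := H.neBot
  have hev := (Metric.tendsto_nhds.1 hlim) (ε ^ 2 / 2) (by positivity)
  obtain ⟨e, he, he0, he1⟩ :=
    (hev.and (H.eventually_nonneg.and H.eventually_norm)).exists
  obtain ⟨c, hc⟩ := CStarAlgebra.nonneg_iff_eq_star_mul_self.1 he0
  have hsa : star (e : B) = e := by
    have : (e : B) = star (c : B) * c := by rw [hc]; rfl
    rw [this, star_mul, star_star]
  have hpos : (0 : B) ≤ e := by
    have : (e : B) = star (c : B) * c := by rw [hc]; rfl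
    rw [this]; exact star_mul_self_nonneg _
  have hcontr : ∀ b : B, ‖b - e * b‖ ≤ ‖b‖ := fun b => by
    refine CStarAlgebra.norm_sub_mul_self_le_of_inr b le_rfl hpos he1 (norm_nonneg _) ?_
    rw [Unitization.inr_zero, sub_zero, mul_one, ← Unitization.inr_star, ← Unitization.inr_mul,
      Unitization.norm_inr, CStarRing.norm_star_mul_self, sq]
  refine ⟨e, e.2.1, hsa, hcontr, ?_⟩
  have h1 : ‖star j * j - star j * j * e‖ < ε ^ 2 / 2 := by
    rw [dist_comm, dist_eq_norm] at he
    exact he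
  have h2 : ‖j - j * e‖ * ‖j - j * e‖ ≤ ‖star j * j - star j * j * e‖ := by
    rw [← CStarRing.norm_star_mul_self]
    have : star (j - j * e) * (j - j * e) =
        (star j * j - star j * j * e) - e * (star j * j - star j * j * e) := by
      rw [star_sub, star_mul, hsa]; noncomm_ring
    rw [this]; exact hcontr _
  nlinarith [norm_nonneg (j - j * e)]

theorem star_mem (J : ClosedIdeal B) {a : B} (ha : a ∈ J) : star a ∈ J := by
  have : star a ∈ closure (J : Set B) := by
    rw [Metric.mem_closure_iff]
    intro ε hε
    obtain ⟨e, he, hs, -, hlt⟩ := J.exists_approx ha hε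
    refine ⟨e * star a, J.mul_mem_right _ he, ?_⟩
    rw [dist_eq_norm, ← norm_star, star_sub, star_mul, star_star, hs]
    exact hlt
  rwa [J.isClosed.closure_eq] at this

instance : StarMemClass (ClosedIdeal B) B where
  star_mem {J} _ h := J.star_mem h

instance instCStarIdeal (J : ClosedIdeal B) : NonUnitalCStarAlgebra J :=
  NonUnitalStarSubalgebra.nonUnitalCStarAlgebra J (h_closed := J.isClosed)

/-- The inclusion of an ideal. -/
def incl (J : ClosedIdeal B) : J →⋆ₙₐ[ℂ] B where
  toFun a := a
  map_smul' _ _ := rfl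
  map_zero' := rfl
  map_add' _ _ := rfl
  map_mul' _ _ := rfl
  map_star' _ := rfl

/-- The quotient `B / J`, with the quotient norm. -/
def Quot (J : ClosedIdeal B) : Type _ := B ⧸ J.toSubmodule

variable (J : ClosedIdeal B)

instance : IsClosed (J.toSubmodule : Set B) := J.isClosed'

instance : NormedAddCommGroup J.Quot :=
  inferInstanceAs (NormedAddCommGroup (B ⧸ J.toSubmodule))
instance : NormedSpace ℂ J.Quot :=
  inferInstanceAs (NormedSpace ℂ (B ⧸ J.toSubmodule))
instance : CompleteSpace J.Quot :=
  inferInstanceAs (CompleteSpace (B ⧸ J.toSubmodule))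

/-- The quotient map, as a linear map. -/
def mkₗ : B →ₗ[ℂ] J.Quot := J.toSubmodule.mkQ

theorem mkₗ_surj : Function.Surjective J.mkₗ := Submodule.mkQ_surjective _

theorem mkₗ_eq {a b : B} : J.mkₗ a = J.mkₗ b ↔ a - b ∈ J := Submodule.Quotient.eq _

theorem mkₗ_eq_zero {a : B} : J.mkₗ a = 0 ↔ a ∈ J := Submodule.Quotient.mk_eq_zero _

theorem norm_mkₗ_le (a : B) : ‖J.mkₗ a‖ ≤ ‖a‖ := Submodule.Quotient.norm_mk_le _ _

theorem exists_norm_lt (x : J.Quot) {ε : ℝ} (hε : 0 < ε) :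
    ∃ a, J.mkₗ a = x ∧ ‖a‖ < ‖x‖ + ε := Submodule.Quotient.norm_mk_lt x hε


instance : Mul J.Quot where
  mul := Quotient.map₂ (· * ·) (by
    intro a a' h b b' k
    have h' : a - a' ∈ J := (Submodule.quotientRel_def _).1 h
    have k' : b - b' ∈ J := (Submodule.quotientRel_def _).1 k
    refine (Submodule.quotientRel_def _).2 ?_
    have : a * b - a' * b' = (a - a') * b + a' * (b - b') := by noncomm_ring
    change a * b - a' * b' ∈ J
    rw [this]
    exact add_mem (J.mul_mem_right _ h') (J.mul_mem_left _ k'))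

instance : Star J.Quot where
  star := Quotient.map star (by
    intro a a' h
    have h' : a - a' ∈ J := (Submodule.quotientRel_def _).1 h
    refine (Submodule.quotientRel_def _).2 ?_
    change star a - star a' ∈ J
    rw [← star_sub]
    exact J.star_mem h')

theorem mkₗ_mul (a b : B) : J.mkₗ (a * b) = J.mkₗ a * J.mkₗ b := rfl

theorem mkₗ_star (a : B) : J.mkₗ (star a) = star (J.mkₗ a) := rfl

theorem le_of_reps {x : J.Quot} {r C : ℝ} (hC : 0 ≤ C) (h : ∀ a, J.mkₗ a = x → r ≤ C * ‖a‖) :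
    r ≤ C * ‖x‖ := by
  refine le_of_forall_pos_le_add fun ε hε => ?_
  obtain ⟨a, ha, hlt⟩ := J.exists_norm_lt x (ε := ε / (C + 1)) (by positivity)
  have h1 := h a ha
  have h2 : C * ‖a‖ ≤ C * (‖x‖ + ε / (C + 1)) := mul_le_mul_of_nonneg_left hlt.le hC
  have h3 : C * (ε / (C + 1)) ≤ ε := by
    rw [mul_div_assoc', div_le_iff₀ (by positivity)]
    nlinarith
  linarith

theorem norm_quot_mul_le (x y : J.Quot) : ‖x * y‖ ≤ ‖x‖ * ‖y‖ := by
  refine J.le_of_reps (norm_nonneg _) fun b hb => ?_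
  rw [mul_comm]
  refine J.le_of_reps (norm_nonneg _) fun a ha => ?_
  rw [← ha, ← hb, ← mkₗ_mul, mul_comm]
  exact (J.norm_mkₗ_le _).trans (norm_mul_le _ _)

instance : NonUnitalNormedRing J.Quot :=
  { (inferInstance : NormedAddCommGroup J.Quot), (inferInstance : Mul J.Quot) with
    left_distrib := by
      intro x y z
      obtain ⟨a, rfl⟩ := J.mkₗ_surj x
      obtain ⟨b, rfl⟩ := J.mkₗ_surj y
      obtain ⟨c, rfl⟩ := J.mkₗ_surj z
      rw [← map_add, ← mkₗ_mul, mul_add, map_add]; rfl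
    right_distrib := by
      intro x y z
      obtain ⟨a, rfl⟩ := J.mkₗ_surj x
      obtain ⟨b, rfl⟩ := J.mkₗ_surj y
      obtain ⟨c, rfl⟩ := J.mkₗ_surj z
      rw [← map_add, ← mkₗ_mul, add_mul, map_add]; rfl
    zero_mul := by
      intro x
      obtain ⟨a, rfl⟩ := J.mkₗ_surj x
      rw [← map_zero J.mkₗ, ← mkₗ_mul, zero_mul]
    mul_zero := by
      intro x
      obtain ⟨a, rfl⟩ := J.mkₗ_surj x
      rw [← map_zero J.mkₗ, ← mkₗ_mul, mul_zero]
    mul_assoc := by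
      intro x y z
      obtain ⟨a, rfl⟩ := J.mkₗ_surj x
      obtain ⟨b, rfl⟩ := J.mkₗ_surj y
      obtain ⟨c, rfl⟩ := J.mkₗ_surj z
      simp only [← mkₗ_mul, mul_assoc]
    norm_mul_le := J.norm_quot_mul_le }

instance : StarRing J.Quot where
  star_involutive := by
    intro x
    obtain ⟨a, rfl⟩ := J.mkₗ_surj x
    rw [← mkₗ_star, ← mkₗ_star, star_star]
  star_mul := by
    intro x y
    obtain ⟨a, rfl⟩ := J.mkₗ_surj x
    obtain ⟨b, rfl⟩ := J.mkₗ_surj y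
    simp only [← mkₗ_star, ← mkₗ_mul, star_mul]
  star_add := by
    intro x y
    obtain ⟨a, rfl⟩ := J.mkₗ_surj x
    obtain ⟨b, rfl⟩ := J.mkₗ_surj y
    rw [← map_add, ← mkₗ_star, star_add, map_add]; rfl

instance : IsScalarTower ℂ J.Quot J.Quot where
  smul_assoc := by
    intro c x y
    obtain ⟨a, rfl⟩ := J.mkₗ_surj x
    obtain ⟨b, rfl⟩ := J.mkₗ_surj y
    simp only [smul_eq_mul, ← map_smul, ← mkₗ_mul, smul_mul_assoc]

instance : SMulCommClass ℂ J.Quot J.Quot where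
  smul_comm := by
    intro c x y
    obtain ⟨a, rfl⟩ := J.mkₗ_surj x
    obtain ⟨b, rfl⟩ := J.mkₗ_surj y
    simp only [smul_eq_mul, ← map_smul, ← mkₗ_mul, mul_smul_comm]

instance : StarModule ℂ J.Quot where
  star_smul := by
    intro c x
    obtain ⟨a, rfl⟩ := J.mkₗ_surj x
    simp only [← map_smul, ← mkₗ_star, star_smul]

theorem norm_quot_sq_le (x : J.Quot) : ‖x‖ * ‖x‖ ≤ ‖star x * x‖ := by
  refine le_of_forall_pos_le_add fun ε hε => ?_
  obtain ⟨a, rfl⟩ := J.mkₗ_surj x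
  obtain ⟨c, hc, hlt⟩ := J.exists_norm_lt (star (J.mkₗ a) * J.mkₗ a) (ε := ε / 2) (by positivity)
  have hj : c - star a * a ∈ J := J.mkₗ_eq.1 hc
  obtain ⟨e, he, hs, hcon, hje⟩ := J.exists_approx hj (ε := ε / 2) (by positivity)
  have hcon' : ∀ b : B, ‖b - b * e‖ ≤ ‖b‖ := fun b => by
    have := hcon (star b)
    rw [← norm_star, star_sub, star_mul, star_star, hs, norm_star] at this
    exact this
  have h1 : ‖J.mkₗ a‖ ≤ ‖a - a * e‖ := by
    have : J.mkₗ a = J.mkₗ (a - a * e) := by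
      rw [mkₗ_eq]
      simpa using J.mul_mem_left a he
    rw [this]; exact J.norm_mkₗ_le _
  have h2 : star (a - a * e) * (a - a * e) =
      ((c - c * e) - e * (c - c * e)) - (((c - star a * a) - (c - star a * a) * e)
        - e * ((c - star a * a) - (c - star a * a) * e)) := by
    rw [star_sub, star_mul, hs]; noncomm_ring
  calc ‖J.mkₗ a‖ * ‖J.mkₗ a‖ ≤ ‖a - a * e‖ * ‖a - a * e‖ := by gcongr
    _ = ‖star (a - a * e) * (a - a * e)‖ := (CStarRing.norm_star_mul_self).symm
    _ ≤ ‖c‖ + ‖(c - star a * a) - (c - star a * a) * e‖ := by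
      rw [h2]
      exact (norm_sub_le _ _).trans (add_le_add ((hcon _).trans (hcon' _)) (hcon _))
    _ ≤ ‖star (J.mkₗ a) * J.mkₗ a‖ + ε := by linarith

instance : CStarRing J.Quot where
  norm_mul_self_le := J.norm_quot_sq_le

instance instCStarQuot : NonUnitalCStarAlgebra J.Quot where

/-- The quotient map. -/
def proj : B →⋆ₙₐ[ℂ] J.Quot where
  toFun := J.mkₗ
  map_smul' c a := map_smul J.mkₗ c a
  map_zero' := map_zero J.mkₗ
  map_add' a b := map_add J.mkₗ a b
  map_mul' := J.mkₗ_mul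
  map_star' := J.mkₗ_star

theorem proj_surj : Function.Surjective J.proj := J.mkₗ_surj

theorem proj_eq {a b : B} : J.proj a = J.proj b ↔ a - b ∈ J := J.mkₗ_eq

theorem proj_eq_zero {a : B} : J.proj a = 0 ↔ a ∈ J := J.mkₗ_eq_zero

theorem norm_proj_le (a : B) : ‖J.proj a‖ ≤ ‖a‖ := J.norm_mkₗ_le a

end ClosedIdeal

/-! ### `C₀(X)`-algebras and their bundles -/

section C0

variable {X : Type*} [TopologicalSpace X] {B : Type*} [NonUnitalCStarAlgebra B]

/-- The action `φ · b = Φ(φ) b` given by a homomorphism of `C₀(X)` into the multipliers of `B`. -/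
def act (Φ : C₀(X, ℂ) →⋆ₙₐ[ℂ] 𝓜(ℂ, B)) (φ : C₀(X, ℂ)) (b : B) : B := (Φ φ).fst b

/-- A ⋆-homomorphism `Φ : C₀(X) → M(B)` makes `B` a `C₀(X)`-algebra if it takes values in the
center of the multiplier algebra and is nondegenerate. -/
structure IsC0Algebra (Φ : C₀(X, ℂ) →⋆ₙₐ[ℂ] 𝓜(ℂ, B)) : Prop where
  central : ∀ φ, Φ φ ∈ Subalgebra.center ℂ 𝓜(ℂ, B)
  nondegenerate : Dense (Submodule.span ℂ {b : B | ∃ φ a, b = act Φ φ a} : Set B)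

variable (X B) in
/-- A `C₀(X)`-algebra structure on a C⋆-algebra `B`. -/
structure C0Algebra where
  Φ : C₀(X, ℂ) →⋆ₙₐ[ℂ] 𝓜(ℂ, B)
  isC0Algebra : IsC0Algebra Φ

theorem eq_of_mul_left {a b : B} (h : ∀ c, c * a = c * b) : a = b := by
  rw [← sub_eq_zero, ← CStarRing.star_mul_self_eq_zero_iff, mul_sub, h, sub_self]

theorem eq_of_mul_right {a b : B} (h : ∀ c, a * c = b * c) : a = b := by
  rw [← sub_eq_zero, ← CStarRing.mul_star_self_eq_zero_iff, sub_mul, h, sub_self]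

theorem fst_mul (m : 𝓜(ℂ, B)) (a b : B) : m.fst (a * b) = m.fst a * b :=
  eq_of_mul_left fun c => by
    rw [← m.central, ← mul_assoc, m.central, mul_assoc]

theorem snd_mul (m : 𝓜(ℂ, B)) (a b : B) : m.snd (a * b) = a * m.snd b :=
  eq_of_mul_right fun c => by
    rw [m.central, mul_assoc, ← m.central, mul_assoc]

/-- The homomorphism into the multiplier algebra given by a family of central multipliers. -/
def mkStructureMap (T : C₀(X, ℂ) → B →L[ℂ] B)
    (central : ∀ φ a b, T φ a * b = a * T φ b)
    (smul : ∀ (c : ℂ) φ a, T (c • φ) a = c • T φ a)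
    (add : ∀ φ ψ a, T (φ + ψ) a = T φ a + T ψ a)
    (mul : ∀ φ ψ a, T (φ * ψ) a = T φ (T ψ a))
    (hstar : ∀ φ a, T (star φ) a = star (T φ (star a))) :
    C₀(X, ℂ) →⋆ₙₐ[ℂ] 𝓜(ℂ, B) where
  toFun φ := ⟨(T φ, T φ), central φ⟩
  map_smul' c φ := by
    apply DoubleCentralizer.ext
    exact Prod.ext (ContinuousLinearMap.ext (smul c φ)) (ContinuousLinearMap.ext (smul c φ))
  map_zero' := by
    have h : T 0 = 0 := ContinuousLinearMap.ext fun a => by simpa using smul 0 0 a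
    apply DoubleCentralizer.ext
    exact Prod.ext h h
  map_add' φ ψ := by
    apply DoubleCentralizer.ext
    exact Prod.ext (ContinuousLinearMap.ext (add φ ψ)) (ContinuousLinearMap.ext (add φ ψ))
  map_mul' φ ψ := by
    apply DoubleCentralizer.ext
    refine Prod.ext (ContinuousLinearMap.ext (mul φ ψ)) (ContinuousLinearMap.ext fun a => ?_)
    change T (φ * ψ) a = T ψ (T φ a)
    rw [mul_comm, mul]
  map_star' φ := by
    apply DoubleCentralizer.ext
    exact Prod.ext (ContinuousLinearMap.ext (hstar φ)) (ContinuousLinearMap.ext (hstar φ))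

theorem mem_center_of_fst_eq_snd (m : 𝓜(ℂ, B)) (h : ∀ a, m.fst a = m.snd a) :
    m ∈ Subalgebra.center ℂ 𝓜(ℂ, B) := by
  have hc : ∀ a b, m.fst a * b = a * m.fst b := fun a b => by rw [h a, m.central]
  rw [Subalgebra.mem_center_iff]
  intro n
  apply DoubleCentralizer.ext
  refine Prod.ext (ContinuousLinearMap.ext fun b => ?_) (ContinuousLinearMap.ext fun b => ?_)
  · change n.fst (m.fst b) = m.fst (n.fst b)
    refine eq_of_mul_right fun d => ?_
    rw [← fst_mul, hc, fst_mul, hc]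
  · change m.snd (n.snd b) = n.snd (m.snd b)
    refine eq_of_mul_left fun d => ?_
    rw [← h, ← h, ← hc, ← snd_mul, ← snd_mul, hc]

namespace C0Algebra

variable (c : C0Algebra X B)

theorem act_add (φ : C₀(X, ℂ)) (a b : B) : act c.Φ φ (a + b) = act c.Φ φ a + act c.Φ φ b :=
  map_add _ _ _

theorem act_mul_right (φ : C₀(X, ℂ)) (a b : B) : act c.Φ φ (a * b) = act c.Φ φ a * b :=
  fst_mul _ _ _

theorem act_mul_left (φ : C₀(X, ℂ)) (a b : B) : act c.Φ φ (a * b) = a * act c.Φ φ b := by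
  have h := Subalgebra.mem_center_iff.1 (c.isC0Algebra.central φ) (a : 𝓜(ℂ, B))
  have h2 := congrArg (fun m : 𝓜(ℂ, B) => m.fst b) h
  exact h2.symm

theorem act_mul (φ ψ : C₀(X, ℂ)) (a : B) : act c.Φ (φ * ψ) a = act c.Φ φ (act c.Φ ψ a) := by
  unfold act
  rw [map_mul]; rfl

theorem act_smul (z : ℂ) (φ : C₀(X, ℂ)) (a : B) : act c.Φ (z • φ) a = z • act c.Φ φ a := by
  unfold act
  rw [map_smul]; rfl

theorem add_act (φ ψ : C₀(X, ℂ)) (a : B) : act c.Φ (φ + ψ) a = act c.Φ φ a + act c.Φ ψ a := by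
  unfold act
  rw [map_add]; rfl

theorem sub_act (φ ψ : C₀(X, ℂ)) (a : B) : act c.Φ (φ - ψ) a = act c.Φ φ a - act c.Φ ψ a := by
  unfold act
  rw [map_sub]; rfl

theorem star_act (φ : C₀(X, ℂ)) (a : B) : act c.Φ (star φ) a = star (act c.Φ φ (star a)) := by
  refine eq_of_mul_right fun d => ?_
  have h1 : ∀ (m : 𝓜(ℂ, B)), (star m).fst a = star (m.snd (star a)) := fun m => rfl
  have h2 : (Φ c φ).snd (star a) = act c.Φ φ (star a) := by
    refine eq_of_mul_right fun d => ?_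
    rw [(Φ c φ).central, ← act_mul_right, act_mul_left]
    rfl
  rw [show act c.Φ (star φ) a = (Φ c (star φ)).fst a from rfl, map_star, h1, h2]

theorem continuous_act (φ : C₀(X, ℂ)) : Continuous (act c.Φ φ) := (Φ c φ).fst.continuous

theorem norm_act_le (φ : C₀(X, ℂ)) (a : B) : ‖act c.Φ φ a‖ ≤ ‖(Φ c φ).fst‖ * ‖a‖ :=
  (Φ c φ).fst.le_opNorm a

theorem act_mem (I : ClosedIdeal B) (φ : C₀(X, ℂ)) {a : B} (ha : a ∈ I) : act c.Φ φ a ∈ I := by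
  have hcl : IsClosed {b | act c.Φ φ b ∈ I} := I.isClosed.preimage (c.continuous_act φ)
  refine hcl.closure_subset (?_ : a ∈ _)
  rw [Metric.mem_closure_iff]
  intro ε hε
  obtain ⟨e, he, -, -, hlt⟩ := I.exists_approx ha hε
  refine ⟨a * e, ?_, by rwa [dist_eq_norm]⟩
  change act c.Φ φ (a * e) ∈ I
  rw [act_mul_left]
  exact I.mul_mem_right _ ha

/-- The `C₀(X)`-algebra structure on an ideal: restrict the action. -/
def ideal (I : ClosedIdeal B) : C0Algebra X I where
  Φ := mkStructureMap
    (fun φ => LinearMap.mkContinuous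
      { toFun := fun a => (⟨act c.Φ φ a, c.act_mem I φ a.2⟩ : I)
        map_add' := fun a b => Subtype.ext (c.act_add φ a b)
        map_smul' := fun z a => Subtype.ext (map_smul (Φ c φ).fst z (a : B)) }
      ‖(Φ c φ).fst‖ (fun a => c.norm_act_le φ a))
    (fun φ a b => Subtype.ext ((c.act_mul_right φ a b).symm.trans (c.act_mul_left φ a b)))
    (fun z φ a => Subtype.ext (c.act_smul z φ a))
    (fun φ ψ a => Subtype.ext (c.add_act φ ψ a))
    (fun φ ψ a => Subtype.ext (c.act_mul φ ψ a))
    (fun φ a => Subtype.ext (c.star_act φ a))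
  isC0Algebra := by
    refine ⟨fun φ => mem_center_of_fst_eq_snd _ fun a => rfl, fun a => ?_⟩
    rw [Metric.mem_closure_iff]
    intro ε hε
    obtain ⟨e, he, hs, hcon, hlt⟩ := I.exists_approx a.2 (ε := ε / 2) (by positivity)
    have hcon' : ∀ b : B, ‖b * e‖ ≤ 2 * ‖b‖ := fun b => by
      have := hcon (star b)
      rw [← norm_star, star_sub, star_mul, star_star, hs, norm_star] at this
      have h2 : b * e = b - (b - b * e) := by abel
      rw [h2]
      linarith [norm_sub_le b (b - b * e)]
    obtain ⟨b, hb, hab⟩ := Metric.mem_closure_iff.1 (c.isC0Algebra.nondegenerate (a : B)) (ε / 4)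
      (by positivity)
    refine ⟨⟨b * e, I.mul_mem_left _ he⟩, ?_, ?_⟩
    · clear hab
      refine Submodule.span_induction
        (p := fun b _ => (⟨b * e, I.mul_mem_left b he⟩ : I) ∈ Submodule.span ℂ _)
        ?_ ?_ ?_ ?_ hb
      · rintro _ ⟨φ, b, rfl⟩
        refine Submodule.subset_span ⟨φ, ⟨b * e, I.mul_mem_left b he⟩, Subtype.ext ?_⟩
        exact (c.act_mul_right φ b e).symm
      · convert Submodule.zero_mem _ using 1
        exact Subtype.ext (zero_mul e)
      · intro x y _ _ hx hy
        convert Submodule.add_mem _ hx hy using 1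
        exact Subtype.ext (add_mul x y e)
      · intro z x _ hx
        convert Submodule.smul_mem _ z hx using 1
        exact Subtype.ext (smul_mul_assoc z x e)
    · rw [dist_eq_norm] at hab ⊢
      change ‖(a : B) - b * e‖ < ε
      have h3 : (a : B) - b * e = (a - a * e) + (a - b) * e := by noncomm_ring
      rw [h3]
      linarith [norm_add_le ((a : B) - a * e) ((a - b) * e), hcon' (a - b)]

/-- The action on a quotient by an ideal, induced from the action on the algebra. -/
def quotAct (I : ClosedIdeal B) (φ : C₀(X, ℂ)) : I.Quot →L[ℂ] I.Quot :=
  LinearMap.mkContinuous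
    (Submodule.mapQ I.toSubmodule I.toSubmodule ((Φ c φ).fst : B →ₗ[ℂ] B)
      (fun _ ha => c.act_mem I φ ha))
    ‖(Φ c φ).fst‖ (fun x => by
      refine I.le_of_reps (norm_nonneg _) fun a ha => ?_
      rw [← ha]
      exact (I.norm_proj_le (act c.Φ φ a)).trans (c.norm_act_le φ a))

theorem quotAct_proj (I : ClosedIdeal B) (φ : C₀(X, ℂ)) (a : B) :
    c.quotAct I φ (I.proj a) = I.proj (act c.Φ φ a) := rfl

/-- The `C₀(X)`-algebra structure on the quotient by an ideal. -/
def quot (I : ClosedIdeal B) : C0Algebra X I.Quot where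
  Φ := mkStructureMap (c.quotAct I)
    (fun φ x y => by
      obtain ⟨a, rfl⟩ := I.proj_surj x
      obtain ⟨b, rfl⟩ := I.proj_surj y
      rw [quotAct_proj, quotAct_proj, ← map_mul, ← map_mul, ← act_mul_left, ← act_mul_right])
    (fun z φ x => by
      obtain ⟨a, rfl⟩ := I.proj_surj x
      rw [quotAct_proj, quotAct_proj, ← map_smul, act_smul])
    (fun φ ψ x => by
      obtain ⟨a, rfl⟩ := I.proj_surj x
      rw [quotAct_proj, quotAct_proj, quotAct_proj, ← map_add, add_act])
    (fun φ ψ x => by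
      obtain ⟨a, rfl⟩ := I.proj_surj x
      rw [quotAct_proj, quotAct_proj, quotAct_proj, act_mul])
    (fun φ x => by
      obtain ⟨a, rfl⟩ := I.proj_surj x
      rw [← map_star I.proj, quotAct_proj, quotAct_proj, ← map_star I.proj, star_act])
  isC0Algebra := by
    refine ⟨fun φ => mem_center_of_fst_eq_snd _ fun a => rfl, ?_⟩
    have hcont : Continuous I.proj :=
      AddMonoidHomClass.continuous_of_bound I.proj 1 fun a => by
        rw [one_mul]; exact I.norm_proj_le a
    have hd := I.proj_surj.denseRange.dense_image hcont c.isC0Algebra.nondegenerate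
    refine hd.mono ?_
    rintro _ ⟨b, hb, rfl⟩
    refine Submodule.span_induction (p := fun b _ => I.proj b ∈ Submodule.span ℂ _) ?_ ?_ ?_ ?_ hb
    · rintro _ ⟨φ, b, rfl⟩
      exact Submodule.subset_span ⟨φ, I.proj b, rfl⟩
    · rw [map_zero]; exact Submodule.zero_mem _
    · intro x y _ _ hx hy
      rw [map_add]; exact Submodule.add_mem _ hx hy
    · intro z x _ hx
      rw [map_smul]; exact Submodule.smul_mem _ z hx

/-- The linear span of the elements `φ · b` with `φ x = 0`. -/
def vanishSpan (x : X) : Submodule ℂ B :=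
  Submodule.span ℂ {b : B | ∃ φ a, φ x = 0 ∧ b = act c.Φ φ a}

/-- The ideal of `B` of elements vanishing at `x`: the closed span of the `φ · b`
with `φ x = 0`. -/
def vanishIdeal (x : X) : ClosedIdeal B where
  toSubmodule := (c.vanishSpan x).topologicalClosure
  mul_mem_left' b a ha := by
    refine map_mem_closure (f := fun a => b * a) (by fun_prop) ha fun y hy => ?_
    refine Submodule.span_induction (p := fun y _ => b * y ∈ c.vanishSpan x) ?_ ?_ ?_ ?_ hy
    · rintro _ ⟨φ, a, h0, rfl⟩
      exact Submodule.subset_span ⟨φ, b * a, h0, (c.act_mul_left φ b a).symm⟩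
    · rw [mul_zero]; exact Submodule.zero_mem _
    · intro x y _ _ hx hy
      rw [mul_add]; exact Submodule.add_mem _ hx hy
    · intro z x _ hx
      rw [mul_smul_comm]; exact Submodule.smul_mem _ z hx
  mul_mem_right' b a ha := by
    refine map_mem_closure (f := fun a => a * b) (by fun_prop) ha fun y hy => ?_
    refine Submodule.span_induction (p := fun y _ => y * b ∈ c.vanishSpan x) ?_ ?_ ?_ ?_ hy
    · rintro _ ⟨φ, a, h0, rfl⟩
      exact Submodule.subset_span ⟨φ, a * b, h0, (c.act_mul_right φ a b).symm⟩
    · rw [zero_mul]; exact Submodule.zero_mem _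
    · intro x y _ _ hx hy
      rw [add_mul]; exact Submodule.add_mem _ hx hy
    · intro z x _ hx
      rw [smul_mul_assoc]; exact Submodule.smul_mem _ z hx
  isClosed' := Submodule.isClosed_topologicalClosure _

/-- The fibre of `B` over `x`. -/
abbrev Fiber (x : X) : Type _ := (c.vanishIdeal x).Quot

/-- The value `b(x)` of `b` in the fibre over `x`. -/
def eval (x : X) : B →⋆ₙₐ[ℂ] c.Fiber x := (c.vanishIdeal x).proj

theorem eval_surj (x : X) : Function.Surjective (c.eval x) := (c.vanishIdeal x).proj_surj

theorem norm_eval_le (x : X) (b : B) : ‖c.eval x b‖ ≤ ‖b‖ := (c.vanishIdeal x).norm_proj_le b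

theorem continuous_eval (x : X) : Continuous (c.eval x) :=
  AddMonoidHomClass.continuous_of_bound (c.eval x) 1 fun a => by
    rw [one_mul]; exact c.norm_eval_le x a

theorem eval_act (x : X) (φ : C₀(X, ℂ)) (b : B) :
    c.eval x (act c.Φ φ b) = φ x • c.eval x b := by
  have hcl : IsClosed {b | c.eval x (act c.Φ φ b) = φ x • c.eval x b} :=
    isClosed_eq ((c.continuous_eval x).comp (c.continuous_act φ))
      ((c.continuous_eval x).const_smul (φ x))
  refine hcl.closure_subset_iff.2 ?_ (c.isC0Algebra.nondegenerate b)
  intro b hb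
  refine Submodule.span_induction
    (p := fun b _ => c.eval x (act c.Φ φ b) = φ x • c.eval x b) ?_ ?_ ?_ ?_ hb
  · rintro _ ⟨ψ, a, rfl⟩
    rw [← map_smul, eval, ClosedIdeal.proj_eq, ← act_mul, ← act_smul, ← sub_act]
    exact subset_closure (Submodule.subset_span ⟨_, a, by simp, rfl⟩)
  · simp [act]
  · intro a b _ _ ha hb
    rw [act_add, map_add, map_add, ha, hb, smul_add]
  · intro z a _ ha
    have : act c.Φ φ (z • a) = z • act c.Φ φ a := map_smul _ _ _
    rw [this, map_smul, map_smul, ha, smul_comm]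

theorem eventually_norm_eval_lt {x : X} {b : B} {r : ℝ} (h : ‖c.eval x b‖ < r) :
    ∀ᶠ y in 𝓝 x, ‖c.eval y b‖ < r := by
  obtain ⟨a, ha, hlt⟩ := (c.vanishIdeal x).exists_norm_lt (c.eval x b) (sub_pos.2 h)
  have hj : b - a ∈ c.vanishIdeal x := (c.vanishIdeal x).proj_eq.1 ha.symm
  have har : 0 < r - ‖a‖ := by linarith
  obtain ⟨j, hj, hd⟩ := Metric.mem_closure_iff.1 hj ((r - ‖a‖) / 2) (by positivity)
  have hlim : Filter.Tendsto (fun y => ‖c.eval y j‖) (𝓝 x) (𝓝 0) := by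
    refine Submodule.span_induction
      (p := fun j _ => Filter.Tendsto (fun y => ‖c.eval y j‖) (𝓝 x) (𝓝 0)) ?_ ?_ ?_ ?_ hj
    · rintro _ ⟨φ, a, h0, rfl⟩
      have h1 : Filter.Tendsto (fun y => ‖φ y‖ * ‖a‖) (𝓝 x) (𝓝 0) := by
        have : Continuous fun y => ‖φ y‖ * ‖a‖ := by fun_prop
        simpa [h0] using this.tendsto x
      refine squeeze_zero (fun _ => norm_nonneg _) (fun y => ?_) h1
      rw [eval_act, norm_smul]
      exact mul_le_mul_of_nonneg_left (c.norm_eval_le y a) (norm_nonneg _)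
    · simp
    · intro a b _ _ ha hb
      refine squeeze_zero (fun _ => norm_nonneg _) (fun y => ?_) (by simpa using ha.add hb)
      rw [map_add]; exact norm_add_le _ _
    · intro z a _ ha
      simpa [norm_smul] using ha.const_mul ‖z‖
  filter_upwards [hlim.eventually_lt_const (show 0 < (r - ‖a‖) / 2 by positivity)] with y hy
  have h1 : b = (b - a - j) + a + j := by abel
  rw [h1, map_add, map_add]
  rw [dist_eq_norm] at hd
  linarith [norm_add₃_le (a := c.eval y (b - a - j)) (b := c.eval y a) (c := c.eval y j),
    c.norm_eval_le y (b - a - j), c.norm_eval_le y a]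

/-- The total space of the upper semicontinuous C⋆-bundle associated to `B`. -/
structure TotalSpace where
  base : X
  pt : c.Fiber base

/-- The tube of radius `ε` around the section of `b` over `U`. -/
def tube (b : B) (U : Set X) (ε : ℝ) : Set c.TotalSpace :=
  {e | e.base ∈ U ∧ ‖e.pt - c.eval e.base b‖ < ε}

/-- The topology of the bundle associated to `B`: the tubes around the sections given
by elements of `B` over open sets form a base. -/
instance : TopologicalSpace c.TotalSpace :=
  TopologicalSpace.generateFrom {W | ∃ b U ε, IsOpen U ∧ 0 < ε ∧ W = c.tube b U ε}

variable {Y : Type*} [TopologicalSpace Y] (ρ : C(Y, X))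

/-- The pullback `ρ⋆ℬ = {(y, e) : ρ y = p e}` of the bundle along `ρ`. -/
def PullbackBundle : Type _ := {z : Y × c.TotalSpace // ρ z.1 = z.2.base}

instance : TopologicalSpace (c.PullbackBundle ρ) := instTopologicalSpaceSubtype

/-- A section of the pullback bundle, as a map into its total space. The fibre of the pullback
bundle over `y` is the fibre of the bundle over `ρ y`. -/
def sectionMap (f : ∀ y, c.Fiber (ρ y)) (y : Y) : c.PullbackBundle ρ :=
  ⟨(y, ⟨ρ y, f y⟩), rfl⟩

theorem continuous_section_iff' (f : ∀ y, c.Fiber (ρ y)) :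
    Continuous (c.sectionMap ρ f) ↔
      ∀ y b ε, ‖f y - c.eval (ρ y) b‖ < ε → ∀ᶠ z in 𝓝 y, ‖f z - c.eval (ρ z) b‖ < ε := by
  have h0 : Continuous (c.sectionMap ρ f) ↔ Continuous fun y => (⟨ρ y, f y⟩ : c.TotalSpace) := by
    refine ⟨fun h => (continuous_snd.comp continuous_subtype_val).comp h, fun h => ?_⟩
    exact Continuous.subtype_mk (continuous_id.prodMk h) _
  rw [h0]
  constructor
  · intro h y b ε hlt
    have ho : IsOpen (c.tube b Set.univ ε) := TopologicalSpace.isOpen_generateFrom_of_mem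
      ⟨b, _, ε, isOpen_univ, (norm_nonneg _).trans_lt hlt, rfl⟩
    have := (ho.preimage h).mem_nhds (x := y) ⟨trivial, hlt⟩
    filter_upwards [this] with z hz using hz.2
  · intro h
    refine continuous_generateFrom_iff.2 ?_
    rintro _ ⟨b, U, ε, hU, -, rfl⟩
    rw [isOpen_iff_mem_nhds]
    rintro y ⟨h1, h2⟩
    filter_upwards [h y b ε h2, (hU.preimage ρ.continuous).mem_nhds h1] with z hz hz'
    exact ⟨hz', hz⟩

theorem continuous_section_iff (f : ∀ y, c.Fiber (ρ y)) :
    Continuous (c.sectionMap ρ f) ↔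
      ∀ y ε, 0 < ε → ∃ b, ∀ᶠ z in 𝓝 y, ‖f z - c.eval (ρ z) b‖ < ε := by
  rw [continuous_section_iff']
  constructor
  · intro h y ε hε
    obtain ⟨b, hb⟩ := c.eval_surj _ (f y)
    exact ⟨b, h y b ε (by rw [hb, sub_self, norm_zero]; exact hε)⟩
  · intro h y b ε hlt
    set δ := (ε - ‖f y - c.eval (ρ y) b‖) / 3 with hδ
    have hδ0 : 0 < δ := by rw [hδ]; linarith
    obtain ⟨b', hb'⟩ := h y δ hδ0
    have h1 : ‖c.eval (ρ y) (b' - b)‖ < ε - δ := by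
      have h2 : c.eval (ρ y) (b' - b) =
          (f y - c.eval (ρ y) b) - (f y - c.eval (ρ y) b') := by
        rw [map_sub]; abel
      rw [h2]
      linarith [norm_sub_le (f y - c.eval (ρ y) b) (f y - c.eval (ρ y) b'), hb'.self_of_nhds]
    filter_upwards [hb', ρ.continuous.continuousAt.eventually (c.eventually_norm_eval_lt h1)]
      with z hz hz'
    have h2 : f z - c.eval (ρ z) b = (f z - c.eval (ρ z) b') + c.eval (ρ z) (b' - b) := by
      rw [map_sub]; abel
    rw [h2]
    linarith [norm_add_le (f z - c.eval (ρ z) b') (c.eval (ρ z) (b' - b))]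

theorem isClosed_norm_ge {f : ∀ y, c.Fiber (ρ y)} (hf : Continuous (c.sectionMap ρ f)) (ε : ℝ) :
    IsClosed {y | ε ≤ ‖f y‖} := by
  rw [← isOpen_compl_iff, isOpen_iff_mem_nhds]
  intro y hy
  have h := (c.continuous_section_iff' ρ f).1 hf y 0 ε (by simpa using hy)
  filter_upwards [h] with z hz
  simpa using hz

end C0Algebra
end C0

/-! ### Pullbacks of `C₀(X)`-algebras -/

namespace C0Algebra

variable {X : Type*} [TopologicalSpace X] {B : Type*} [NonUnitalCStarAlgebra B]
  (c : C0Algebra X B) {Y : Type*} [TopologicalSpace Y] (ρ : C(Y, X))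

/-- A section of the pullback bundle belongs to `Γ₀(Y, ρ⋆ℬ)` if it is continuous and vanishes
at infinity. -/
structure IsC0Section (f : ∀ y, c.Fiber (ρ y)) : Prop where
  continuous : Continuous (c.sectionMap ρ f)
  vanish : ∀ ε : ℝ, 0 < ε → IsCompact {y | ε ≤ ‖f y‖}

theorem IsC0Section.of_le {f g : ∀ y, c.Fiber (ρ y)} (hf : IsC0Section c ρ f)
    (hg : Continuous (c.sectionMap ρ g)) {C : ℝ} (hC : 0 ≤ C) (h : ∀ y, ‖g y‖ ≤ C * ‖f y‖) :
    IsC0Section c ρ g := by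
  refine ⟨hg, fun ε hε => ?_⟩
  refine (hf.vanish (ε / (C + 1)) (by positivity)).of_isClosed_subset
    (c.isClosed_norm_ge ρ hg ε) fun y hy => ?_
  have hy' : ε ≤ ‖g y‖ := hy
  change ε / (C + 1) ≤ ‖f y‖
  rw [div_le_iff₀ (by positivity)]
  nlinarith [h y, norm_nonneg (f y)]

/-- The C⋆-algebra `ρ⋆B = Γ₀(Y, ρ⋆ℬ)` of continuous sections of the pullback bundle which vanish
at infinity, with pointwise operations and the supremum norm, as a subalgebra of the algebra of
all bounded sections (sections vanishing at infinity are automatically bounded). -/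
def pullback : NonUnitalStarSubalgebra ℂ (lp (fun y => c.Fiber (ρ y)) ∞) where
  carrier := {f | IsC0Section c ρ f}
  add_mem' {f g} hf hg := by
    have hcont : Continuous (c.sectionMap ρ (f + g : lp (fun y => c.Fiber (ρ y)) ∞)) := by
      rw [continuous_section_iff]
      intro y ε hε
      obtain ⟨a, ha⟩ := (c.continuous_section_iff ρ _).1 hf.continuous y (ε / 2) (by positivity)
      obtain ⟨b, hb⟩ := (c.continuous_section_iff ρ _).1 hg.continuous y (ε / 2) (by positivity)
      refine ⟨a + b, ?_⟩
      filter_upwards [ha, hb] with z h1 h2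
      have h3 : (f + g) z - c.eval (ρ z) (a + b) =
          (f z - c.eval (ρ z) a) + (g z - c.eval (ρ z) b) := by
        rw [map_add, lp.coeFn_add, Pi.add_apply]; abel
      rw [h3]
      linarith [norm_add_le (f z - c.eval (ρ z) a) (g z - c.eval (ρ z) b)]
    refine ⟨hcont, fun ε hε => ?_⟩
    refine ((hf.vanish (ε / 2) (by positivity)).union
      (hg.vanish (ε / 2) (by positivity))).of_isClosed_subset
      (c.isClosed_norm_ge ρ hcont ε) fun y hy => ?_
    have hy' : ε ≤ ‖f y + g y‖ := hy
    by_contra hcon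
    simp only [Set.mem_union, Set.mem_ofPred_eq, not_or, not_le] at hcon
    linarith [norm_add_le (f y) (g y)]
  zero_mem' := by
    have hcont : Continuous (c.sectionMap ρ (0 : lp (fun y => c.Fiber (ρ y)) ∞)) := by
      rw [continuous_section_iff]
      intro y ε hε
      refine ⟨0, Filter.Eventually.of_forall fun z => ?_⟩
      simpa using hε
    refine ⟨hcont, fun ε hε => ?_⟩
    convert isCompact_empty
    ext y
    simpa using hε
  mul_mem' {f g} hf hg := by
    refine IsC0Section.of_le c ρ hg ?_ (norm_nonneg f) fun y => ?_
    · rw [continuous_section_iff]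
      intro y ε hε
      obtain ⟨b, hb⟩ := (c.continuous_section_iff ρ _).1 hg.continuous y (ε / (2 * (‖f‖ + 1)))
        (by positivity)
      obtain ⟨a, ha⟩ := (c.continuous_section_iff ρ _).1 hf.continuous y (ε / (2 * (‖b‖ + 1)))
        (by positivity)
      refine ⟨a * b, ?_⟩
      filter_upwards [ha, hb] with z h1 h2
      have h3 : (f * g) z - c.eval (ρ z) (a * b) =
          f z * (g z - c.eval (ρ z) b) + (f z - c.eval (ρ z) a) * c.eval (ρ z) b := by
        rw [map_mul, lp.infty_coeFn_mul, Pi.mul_apply]; noncomm_ring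
      have hfz : ‖f z‖ ≤ ‖f‖ := lp.norm_apply_le_norm ENNReal.top_ne_zero f z
      have hbz := c.norm_eval_le (ρ z) b
      rw [lt_div_iff₀ (by positivity)] at h1 h2
      have h4 : ‖f z * (g z - c.eval (ρ z) b)‖ ≤ ‖f‖ * ‖g z - c.eval (ρ z) b‖ :=
        (norm_mul_le _ _).trans (by gcongr)
      have h5 : ‖(f z - c.eval (ρ z) a) * c.eval (ρ z) b‖ ≤ ‖f z - c.eval (ρ z) a‖ * ‖b‖ :=
        (norm_mul_le _ _).trans (by gcongr)
      rw [h3]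
      have h6 := norm_add_le (f z * (g z - c.eval (ρ z) b))
        ((f z - c.eval (ρ z) a) * c.eval (ρ z) b)
      nlinarith [norm_nonneg (g z - c.eval (ρ z) b), norm_nonneg (f z - c.eval (ρ z) a)]
    · rw [lp.infty_coeFn_mul, Pi.mul_apply]
      refine (norm_mul_le _ _).trans ?_
      gcongr
      exact lp.norm_apply_le_norm ENNReal.top_ne_zero f y
  smul_mem' r f hf := by
    refine IsC0Section.of_le c ρ hf ?_ (norm_nonneg r) fun y => ?_
    · rw [continuous_section_iff]
      intro y ε hε
      obtain ⟨a, ha⟩ := (c.continuous_section_iff ρ _).1 hf.continuous y (ε / (‖r‖ + 1))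
        (by positivity)
      refine ⟨r • a, ?_⟩
      filter_upwards [ha] with z h1
      rw [map_smul, lp.coeFn_smul, Pi.smul_apply, ← smul_sub, norm_smul]
      rw [lt_div_iff₀ (by positivity)] at h1
      nlinarith [norm_nonneg (f z - c.eval (ρ z) a)]
    · rw [lp.coeFn_smul, Pi.smul_apply, norm_smul]
  star_mem' {f} hf := by
    refine IsC0Section.of_le c ρ hf ?_ zero_le_one fun y => ?_
    · rw [continuous_section_iff]
      intro y ε hε
      obtain ⟨a, ha⟩ := (c.continuous_section_iff ρ _).1 hf.continuous y ε hε
      refine ⟨star a, ?_⟩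
      filter_upwards [ha] with z h1
      rwa [map_star, lp.coeFn_star, Pi.star_apply, ← star_sub, norm_star]
    · rw [lp.coeFn_star, Pi.star_apply, norm_star, one_mul]

theorem isClosed_pullback : IsClosed (c.pullback ρ : Set (lp (fun y => c.Fiber (ρ y)) ∞)) := by
  refine isClosed_of_closure_subset fun f hf => ?_
  have happ : ∀ ε : ℝ, 0 < ε → ∃ g ∈ c.pullback ρ, ∀ y, ‖f y - g y‖ < ε := fun ε hε => by
    obtain ⟨g, hg, hd⟩ := Metric.mem_closure_iff.1 hf ε hε
    refine ⟨g, hg, fun y => ?_⟩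
    rw [dist_eq_norm] at hd
    exact (lp.norm_apply_le_norm ENNReal.top_ne_zero (f - g) y).trans_lt hd
  have hcont : Continuous (c.sectionMap ρ f) := by
    rw [continuous_section_iff]
    intro y ε hε
    obtain ⟨g, hg, hd⟩ := happ (ε / 2) (by positivity)
    obtain ⟨a, ha⟩ := (c.continuous_section_iff ρ _).1 hg.continuous y (ε / 2) (by positivity)
    refine ⟨a, ?_⟩
    filter_upwards [ha] with z h1
    have h3 : f z - c.eval (ρ z) a = (f z - g z) + (g z - c.eval (ρ z) a) := by abel
    rw [h3]
    linarith [norm_add_le (f z - g z) (g z - c.eval (ρ z) a), hd z]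
  refine ⟨hcont, fun ε hε => ?_⟩
  obtain ⟨g, hg, hd⟩ := happ (ε / 2) (by positivity)
  refine (hg.vanish (ε / 2) (by positivity)).of_isClosed_subset
    (c.isClosed_norm_ge ρ hcont ε) fun y hy => ?_
  have hy' : ε ≤ ‖f y‖ := hy
  change ε / 2 ≤ ‖g y‖
  have h3 : f y = (f y - g y) + g y := by abel
  have := norm_add_le (f y - g y) (g y)
  rw [← h3] at this
  linarith [hd y]

instance instCStarPullback : NonUnitalCStarAlgebra (c.pullback ρ) :=
  NonUnitalStarSubalgebra.nonUnitalCStarAlgebra (c.pullback ρ) (h_closed := c.isClosed_pullback ρ)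

/-- Build an element of `ρ⋆B` from a section. -/
def mkSection (f : ∀ y, c.Fiber (ρ y)) (hf : IsC0Section c ρ f) {C : ℝ} (h : ∀ y, ‖f y‖ ≤ C) :
    c.pullback ρ :=
  ⟨⟨f, memℓp_infty ⟨C, by rintro _ ⟨y, rfl⟩; exact h y⟩⟩, hf⟩

theorem norm_apply_le (f : c.pullback ρ) (y : Y) : ‖f.1 y‖ ≤ ‖f‖ :=
  lp.norm_apply_le_norm ENNReal.top_ne_zero f.1 y

theorem norm_C0_apply_le (φ : C₀(Y, ℂ)) (y : Y) : ‖φ y‖ ≤ ‖φ‖ := by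
  rw [← ZeroAtInftyContinuousMap.norm_toBCF_eq_norm]
  exact φ.toBCF.norm_coe_le_norm y

/-- Pointwise multiplication of a section by a function. -/
def pullbackSmul (φ : C₀(Y, ℂ)) (f : c.pullback ρ) : c.pullback ρ :=
  c.mkSection ρ (fun y => φ y • f.1 y)
    (by
      have hle : ∀ y, ‖φ y • f.1 y‖ ≤ ‖φ‖ * ‖f.1 y‖ := fun y => by
        rw [norm_smul]
        exact mul_le_mul_of_nonneg_right (norm_C0_apply_le φ y) (norm_nonneg _)
      refine IsC0Section.of_le c ρ f.2 ?_ (norm_nonneg φ) hle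
      rw [continuous_section_iff]
      intro y ε hε
      obtain ⟨a, ha⟩ := (c.continuous_section_iff ρ _).1 f.2.continuous y (ε / (2 * (‖φ‖ + 1)))
        (by positivity)
      have hφ : ∀ᶠ z in 𝓝 y, ‖φ z - φ y‖ < ε / (2 * (‖a‖ + 1)) := by
        have := Metric.tendsto_nhds.1 ((map_continuous φ).tendsto y) (ε / (2 * (‖a‖ + 1)))
          (by positivity)
        simpa only [dist_eq_norm] using this
      refine ⟨φ y • a, ?_⟩
      filter_upwards [ha, hφ] with z h1 h2
      have h3 : φ z • f.1 z - c.eval (ρ z) (φ y • a) =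
          φ z • (f.1 z - c.eval (ρ z) a) + (φ z - φ y) • c.eval (ρ z) a := by
        rw [map_smul, smul_sub, sub_smul]; abel
      rw [lt_div_iff₀ (by positivity)] at h1 h2
      have h4 : ‖φ z • (f.1 z - c.eval (ρ z) a)‖ ≤ ‖φ‖ * ‖f.1 z - c.eval (ρ z) a‖ := by
        rw [norm_smul]
        exact mul_le_mul_of_nonneg_right (norm_C0_apply_le φ z) (norm_nonneg _)
      have h5 : ‖(φ z - φ y) • c.eval (ρ z) a‖ ≤ ‖φ z - φ y‖ * ‖a‖ := by
        rw [norm_smul]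
        exact mul_le_mul_of_nonneg_left (c.norm_eval_le _ _) (norm_nonneg _)
      rw [h3]
      have h6 := norm_add_le (φ z • (f.1 z - c.eval (ρ z) a)) ((φ z - φ y) • c.eval (ρ z) a)
      nlinarith [norm_nonneg (φ z - φ y), norm_nonneg (f.1 z - c.eval (ρ z) a)])
    (C := ‖φ‖ * ‖f‖)
    (fun y => by
      rw [norm_smul]
      exact mul_le_mul (norm_C0_apply_le φ y) (c.norm_apply_le ρ f y) (norm_nonneg _)
        (norm_nonneg _))

theorem pullback_ext {f g : c.pullback ρ} (h : ∀ y, f.1 y = g.1 y) : f = g :=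
  Subtype.ext (lp.ext (funext h))

theorem norm_pullback_le {f : c.pullback ρ} {C : ℝ} (hC : 0 ≤ C) (h : ∀ y, ‖f.1 y‖ ≤ C) :
    ‖f‖ ≤ C := lp.norm_le_of_forall_le hC h

/-- The homomorphism `C₀(Y) → M(ρ⋆B)` given by pointwise multiplication of sections. -/
def pullbackΦ : C₀(Y, ℂ) →⋆ₙₐ[ℂ] 𝓜(ℂ, c.pullback ρ) :=
  mkStructureMap
    (fun φ => LinearMap.mkContinuous
      { toFun := c.pullbackSmul ρ φ
        map_add' := fun f g => c.pullback_ext ρ fun y => smul_add (φ y) (f.1 y) (g.1 y)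
        map_smul' := fun z f => c.pullback_ext ρ fun y => smul_comm (φ y) z (f.1 y) }
      ‖φ‖ (fun f => c.norm_pullback_le ρ (by positivity) fun y => by
        refine (norm_smul_le (φ y) (f.1 y)).trans ?_
        exact mul_le_mul (norm_C0_apply_le φ y) (c.norm_apply_le ρ f y) (norm_nonneg _)
          (norm_nonneg _)))
    (fun φ f g => c.pullback_ext ρ fun y =>
      (smul_mul_assoc (φ y) (f.1 y) (g.1 y)).trans (mul_smul_comm (φ y) (f.1 y) (g.1 y)).symm)
    (fun z φ f => c.pullback_ext ρ fun y => smul_assoc z (φ y) (f.1 y))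
    (fun φ ψ f => c.pullback_ext ρ fun y => add_smul (φ y) (ψ y) (f.1 y))
    (fun φ ψ f => c.pullback_ext ρ fun y => mul_smul (φ y) (ψ y) (f.1 y))
    (fun φ f => c.pullback_ext ρ fun y => by
      change star (φ y) • f.1 y = star (φ y • star (f.1 y))
      rw [star_smul, star_star])

theorem act_pullbackΦ_apply (φ : C₀(Y, ℂ)) (f : c.pullback ρ) (y : Y) :
    (act (c.pullbackΦ ρ) φ f).1 y = φ y • f.1 y := rfl

end C0Algebra

section C0Hom

variable {X : Type*} [TopologicalSpace X] {B C : Type*} [NonUnitalCStarAlgebra B]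
  [NonUnitalCStarAlgebra C]

/-- A `C₀(X)`-linear ⋆-homomorphism of `C₀(X)`-algebras. -/
structure C0Hom (b : C0Algebra X B) (c : C0Algebra X C) extends B →⋆ₙₐ[ℂ] C where
  map_act : ∀ (φ : C₀(X, ℂ)) (a : B), toFun (act b.Φ φ a) = act c.Φ φ (toFun a)

namespace C0Hom

variable {b : C0Algebra X B} {c : C0Algebra X C} (ψ : C0Hom b c)

theorem map_vanish (x : X) {a : B} (ha : a ∈ b.vanishIdeal x) :
    ψ.toNonUnitalStarAlgHom a ∈ c.vanishIdeal x := by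
  refine map_mem_closure (f := ψ.toNonUnitalStarAlgHom)
    (AddMonoidHomClass.continuous_of_bound ψ.toNonUnitalStarAlgHom 1 fun a => by
      rw [one_mul]; exact NonUnitalStarAlgHom.norm_apply_le _ a) ha fun y hy => ?_
  refine Submodule.span_induction
    (p := fun y _ => ψ.toNonUnitalStarAlgHom y ∈ c.vanishSpan x) ?_ ?_ ?_ ?_ hy
  · rintro _ ⟨φ, a, h0, rfl⟩
    exact Submodule.subset_span ⟨φ, _, h0, ψ.map_act φ a⟩
  · rw [map_zero]; exact Submodule.zero_mem _
  · intro x y _ _ hx hy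
    rw [map_add]; exact Submodule.add_mem _ hx hy
  · intro z x _ hx
    rw [map_smul]; exact Submodule.smul_mem _ z hx

/-- The map `ψ_x` on fibres, characterized by `ψ_x (a(x)) = ψ(a)(x)`. -/
def fiberMap (x : X) : b.Fiber x →⋆ₙₐ[ℂ] c.Fiber x where
  toFun := Submodule.mapQ (b.vanishIdeal x).toSubmodule (c.vanishIdeal x).toSubmodule
    (LinearMapClass.linearMap ψ.toNonUnitalStarAlgHom) (fun _ ha => ψ.map_vanish x ha)
  map_smul' z e := map_smul (Submodule.mapQ (b.vanishIdeal x).toSubmodule _ _ _) z e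
  map_zero' := map_zero (Submodule.mapQ (b.vanishIdeal x).toSubmodule _ _ _)
  map_add' e e' := map_add (Submodule.mapQ (b.vanishIdeal x).toSubmodule _ _ _) e e'
  map_mul' e e' := by
    obtain ⟨a, rfl⟩ := b.eval_surj x e
    obtain ⟨a', rfl⟩ := b.eval_surj x e'
    change c.eval x (ψ.toNonUnitalStarAlgHom (a * a')) =
      c.eval x (ψ.toNonUnitalStarAlgHom a) * c.eval x (ψ.toNonUnitalStarAlgHom a')
    rw [map_mul, map_mul]
  map_star' e := by
    obtain ⟨a, rfl⟩ := b.eval_surj x e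
    change c.eval x (ψ.toNonUnitalStarAlgHom (star a)) =
      star (c.eval x (ψ.toNonUnitalStarAlgHom a))
    rw [map_star, map_star]

theorem fiberMap_eval (x : X) (a : B) :
    ψ.fiberMap x (b.eval x a) = c.eval x (ψ.toNonUnitalStarAlgHom a) := rfl

theorem norm_fiberMap_le (x : X) (e : b.Fiber x) : ‖ψ.fiberMap x e‖ ≤ ‖e‖ :=
  NonUnitalStarAlgHom.norm_apply_le _ e

variable {Y : Type*} [TopologicalSpace Y] (ρ : C(Y, X))

theorem isC0Section_map (f : b.pullback ρ) :
    c.IsC0Section ρ fun y => ψ.fiberMap (ρ y) (f.1 y) := by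
  have hcont : Continuous (c.sectionMap ρ fun y => ψ.fiberMap (ρ y) (f.1 y)) := by
    rw [C0Algebra.continuous_section_iff]
    intro y ε hε
    obtain ⟨a, ha⟩ := (b.continuous_section_iff ρ _).1 f.2.continuous y ε hε
    refine ⟨ψ.toNonUnitalStarAlgHom a, ?_⟩
    filter_upwards [ha] with z hz
    rw [← fiberMap_eval, ← map_sub]
    exact (ψ.norm_fiberMap_le _ _).trans_lt hz
  refine ⟨hcont, fun ε hε => ?_⟩
  refine (f.2.vanish ε hε).of_isClosed_subset (c.isClosed_norm_ge ρ hcont ε) fun y hy => ?_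
  exact le_trans (show ε ≤ ‖ψ.fiberMap (ρ y) (f.1 y)‖ from hy) (ψ.norm_fiberMap_le _ _)

/-- The pullback `ρ⋆ψ : ρ⋆B → ρ⋆C`, given by `(ρ⋆ψ)(f)(y) = ψ_{ρ y}(f y)`. -/
def pullback : b.pullback ρ →⋆ₙₐ[ℂ] c.pullback ρ where
  toFun f := c.mkSection ρ (fun y => ψ.fiberMap (ρ y) (f.1 y)) (ψ.isC0Section_map ρ f) (C := ‖f‖)
    fun y => (ψ.norm_fiberMap_le _ _).trans (b.norm_apply_le ρ f y)
  map_smul' z f := c.pullback_ext ρ fun y => map_smul (ψ.fiberMap (ρ y)) z (f.1 y)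
  map_zero' := c.pullback_ext ρ fun y => map_zero (ψ.fiberMap (ρ y))
  map_add' f g := c.pullback_ext ρ fun y => map_add (ψ.fiberMap (ρ y)) (f.1 y) (g.1 y)
  map_mul' f g := c.pullback_ext ρ fun y => map_mul (ψ.fiberMap (ρ y)) (f.1 y) (g.1 y)
  map_star' f := c.pullback_ext ρ fun y => map_star (ψ.fiberMap (ρ y)) (f.1 y)

theorem pullback_apply (f : b.pullback ρ) (y : Y) :
    (ψ.pullback ρ f).1 y = ψ.fiberMap (ρ y) (f.1 y) := rfl

end C0Hom

/-- The inclusion `ι : I → A` as a map of `C₀(X)`-algebras. -/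
def C0Algebra.ι (c : C0Algebra X B) (I : ClosedIdeal B) : C0Hom (c.ideal I) c where
  toNonUnitalStarAlgHom := I.incl
  map_act _ _ := rfl

/-- The quotient map `q : A → A/I` as a map of `C₀(X)`-algebras. -/
def C0Algebra.q (c : C0Algebra X B) (I : ClosedIdeal B) : C0Hom c (c.quot I) where
  toNonUnitalStarAlgHom := I.proj
  map_act _ _ := rfl

end C0Hom

/-! ### Topological groupoids, Haar systems and dynamical systems -/

/-- A topological groupoid `G`, given by its space of arrows. Units are identified with the
corresponding identity arrows; `comp γ η` is the product `γη`, defined when `s γ = r η`. -/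
class TopologicalGroupoid (G : Type*) [TopologicalSpace G] where
  r : G → G
  s : G → G
  inv : G → G
  comp : (γ η : G) → s γ = r η → G
  s_r : ∀ γ, s (r γ) = r γ
  r_s : ∀ γ, r (s γ) = s γ
  r_comp : ∀ γ η h, r (comp γ η h) = r γ
  s_comp : ∀ γ η h, s (comp γ η h) = s η
  assoc : ∀ γ η ξ (h : s γ = r η) (k : s η = r ξ),
    comp (comp γ η h) ξ ((s_comp γ η h).trans k) = comp γ (comp η ξ k) (h.trans (r_comp η ξ k).symm)
  unit_comp : ∀ γ, comp (r γ) γ (s_r γ) = γ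
  comp_unit : ∀ γ, comp γ (s γ) (r_s γ).symm = γ
  s_inv : ∀ γ, s (inv γ) = r γ
  r_inv : ∀ γ, r (inv γ) = s γ
  inv_comp : ∀ γ, comp (inv γ) γ (s_inv γ) = s γ
  comp_inv : ∀ γ, comp γ (inv γ) (r_inv γ).symm = r γ
  continuous_inv' : Continuous inv
  continuous_comp' : Continuous fun p : {p : G × G // s p.1 = r p.2} => comp p.1.1 p.1.2 p.2

open TopologicalGroupoid

section Groupoid

variable {G : Type*} [TopologicalSpace G] [TopologicalGroupoid G]

theorem r_r (γ : G) : r (r γ) = r γ := by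
  have h := r_comp (r γ) γ (s_r γ)
  rw [unit_comp] at h
  exact h.symm

theorem continuous_r : Continuous (r : G → G) := by
  have h : (r : G → G) = (fun p : {p : G × G // s p.1 = r p.2} => comp p.1.1 p.1.2 p.2) ∘
      fun γ => ⟨(γ, inv γ), (r_inv γ).symm⟩ := funext fun γ => (comp_inv γ).symm
  rw [h]
  exact continuous_comp'.comp (Continuous.subtype_mk (continuous_id.prodMk continuous_inv') _)

variable (G) in
/-- The unit space `G⁽⁰⁾`, with the relative topology. -/
abbrev UnitSpace : Type _ := {u : G // r u = u}

/-- The range map `G → G⁽⁰⁾`. -/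
def rU (γ : G) : UnitSpace G := ⟨r γ, r_r γ⟩

/-- The source map `G → G⁽⁰⁾`. -/
def sU (γ : G) : UnitSpace G := ⟨s γ, r_s γ⟩

theorem continuous_rU : Continuous (rU : G → UnitSpace G) := continuous_r.subtype_mk _

open Classical in
variable (G) in
/-- A continuous (left) Haar system on `G`: a family of Radon measures `λ^u`, `u ∈ G⁽⁰⁾`, with
`supp λ^u = r⁻¹(u)`, continuous in `u` and left invariant. -/
structure HaarSystem [MeasurableSpace G] [BorelSpace G] where
  measure : UnitSpace G → MeasureTheory.Measure G
  regular : ∀ u, (measure u).Regular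
  support_eq : ∀ u, (measure u).support = {γ : G | r γ = (u : G)}
  continuous_integral : ∀ f : G → ℂ, Continuous f → HasCompactSupport f →
    Continuous fun u => ∫ γ, f γ ∂measure u
  left_invariant : ∀ f : G → ℂ, Continuous f → HasCompactSupport f → ∀ γ : G,
    ∫ η, (if h : s γ = r η then f (comp γ η h) else 0) ∂measure (sU γ) =
      ∫ η, f η ∂measure (rU γ)

variable (G) in
/-- A closed subgroupoid of `G`. -/
structure ClosedSubgroupoid where
  carrier : Set G
  comp_mem' : ∀ {γ η : G} (h : s γ = r η), γ ∈ carrier → η ∈ carrier → comp γ η h ∈ carrier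
  inv_mem' : ∀ {γ : G}, γ ∈ carrier → inv γ ∈ carrier
  isClosed' : IsClosed carrier

namespace ClosedSubgroupoid

instance : SetLike (ClosedSubgroupoid G) G where
  coe H := H.carrier
  coe_injective := by
    rintro ⟨_, _, _, _⟩ ⟨_, _, _, _⟩ h
    congr

variable (H : ClosedSubgroupoid G)

theorem comp_mem {γ η : G} (h : s γ = r η) (hγ : γ ∈ H) (hη : η ∈ H) : comp γ η h ∈ H :=
  H.comp_mem' h hγ hη

theorem inv_mem {γ : G} (hγ : γ ∈ H) : inv γ ∈ H := H.inv_mem' hγ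

theorem r_mem {γ : G} (hγ : γ ∈ H) : r γ ∈ H := by
  rw [← comp_inv]
  exact H.comp_mem _ hγ (H.inv_mem hγ)

theorem s_mem {γ : G} (hγ : γ ∈ H) : s γ ∈ H := by
  rw [← inv_comp]
  exact H.comp_mem _ (H.inv_mem hγ) hγ

/-- A closed subgroupoid is a topological groupoid. -/
instance : TopologicalGroupoid H where
  r γ := ⟨r γ.1, H.r_mem γ.2⟩
  s γ := ⟨s γ.1, H.s_mem γ.2⟩
  inv γ := ⟨inv γ.1, H.inv_mem γ.2⟩
  comp γ η h := ⟨comp γ.1 η.1 (Subtype.ext_iff.1 h), H.comp_mem _ γ.2 η.2⟩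
  s_r γ := Subtype.ext (s_r γ.1)
  r_s γ := Subtype.ext (r_s γ.1)
  r_comp γ η _ := Subtype.ext (r_comp γ.1 η.1 _)
  s_comp γ η _ := Subtype.ext (s_comp γ.1 η.1 _)
  assoc γ η ξ _ _ := Subtype.ext (assoc γ.1 η.1 ξ.1 _ _)
  unit_comp γ := Subtype.ext (unit_comp γ.1)
  comp_unit γ := Subtype.ext (comp_unit γ.1)
  s_inv γ := Subtype.ext (s_inv γ.1)
  r_inv γ := Subtype.ext (r_inv γ.1)
  inv_comp γ := Subtype.ext (inv_comp γ.1)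
  comp_inv γ := Subtype.ext (comp_inv γ.1)
  continuous_inv' := (continuous_inv'.comp continuous_subtype_val).subtype_mk _
  continuous_comp' := by
    have h : Continuous fun p : {p : H × H //
        (⟨s p.1.1, H.s_mem p.1.2⟩ : H) = ⟨r p.2.1, H.r_mem p.2.2⟩} =>
        (⟨((p.1.1 : G), (p.1.2 : G)), Subtype.ext_iff.1 p.2⟩ : {p : G × G // s p.1 = r p.2}) :=
      Continuous.subtype_mk (by fun_prop) _
    exact (continuous_comp'.comp h).subtype_mk _

/-- The space `X = s⁻¹(H⁽⁰⁾)`, on which `H` acts on the right by multiplication. -/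
abbrev SourceSpace : Type _ := {γ : G // s γ ∈ H}

/-- The orbit equivalence relation of the right `H`-action on `X`: `γ ∼ γη` for `η ∈ H`
with `r η = s γ`. -/
def orbitSetoid : Setoid H.SourceSpace where
  r γ γ' := ∃ η ∈ H, ∃ h : s γ.1 = r η, γ'.1 = comp γ.1 η h
  iseqv := by
    refine ⟨fun γ => ⟨s γ.1, γ.2, (r_s _).symm, (comp_unit _).symm⟩, ?_, ?_⟩
    · rintro ⟨γ, hγ⟩ ⟨γ', hγ'⟩ ⟨η, hη, h, rfl⟩
      refine ⟨inv η, H.inv_mem hη, (s_comp _ _ _).trans (r_inv _).symm, ?_⟩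
      change γ = comp (comp γ η h) (inv η) _
      rw [assoc γ η (inv η) h (r_inv _).symm]
      have : ∀ (ξ : G) (hξ : s γ = r ξ), ξ = s γ → comp γ ξ hξ = γ := by
        rintro _ hξ rfl
        exact comp_unit γ
      exact (this _ _ ((comp_inv η).trans h.symm)).symm
    · rintro ⟨γ, hγ⟩ ⟨γ', hγ'⟩ ⟨γ'', hγ''⟩ ⟨η, hη, h, rfl⟩ ⟨ξ, hξ, k, rfl⟩
      have k' : s η = r ξ := (s_comp _ _ _).symm.trans k
      exact ⟨comp η ξ k', H.comp_mem _ hη hξ, h.trans (r_comp _ _ _).symm, assoc γ η ξ h k'⟩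

/-- The orbit space `X/H`, with the quotient topology. -/
def OrbitSpace : Type _ := Quotient H.orbitSetoid

instance : TopologicalSpace H.OrbitSpace :=
  inferInstanceAs (TopologicalSpace (Quotient H.orbitSetoid))

/-- The map `ρ : X/H → G⁽⁰⁾`, `ρ([γ]) = r(γ)`. -/
def ρ : C(H.OrbitSpace, UnitSpace G) where
  toFun := Quotient.lift (fun γ : H.SourceSpace => rU γ.1) (by
    rintro ⟨γ, hγ⟩ ⟨γ', hγ'⟩ ⟨η, hη, h, rfl⟩
    exact Subtype.ext (r_comp _ _ _).symm)
  continuous_toFun := (continuous_rU.comp continuous_subtype_val).quotient_lift _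

end ClosedSubgroupoid

variable {A : Type*} [NonUnitalCStarAlgebra A]

/-- Given isomorphisms `α_γ : 𝒜_{s(γ)} → 𝒜_{r(γ)}`, the element `γ · e = α_γ(e)` of the total
space of the bundle, for `e` in the fibre over `s(γ)`. -/
def arrowAct (c : C0Algebra (UnitSpace G) A)
    (α : ∀ γ : G, c.Fiber (sU γ) ≃⋆ₐ[ℂ] c.Fiber (rU γ))
    (γ : G) (e : c.TotalSpace) (h : e.base = sU γ) : c.TotalSpace :=
  ⟨rU γ, α γ (h ▸ e.pt)⟩

/-- An action `α` of `G` on the upper semicontinuous C⋆-bundle `𝒜` over `G⁽⁰⁾` associated to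
`A`, so that `(𝒜, G, α)` is a groupoid dynamical system: ⋆-isomorphisms
`α_γ : 𝒜_{s(γ)} → 𝒜_{r(γ)}` with `α_{γη} = α_γ ∘ α_η`, such that `(γ, e) ↦ γ · e` is
continuous from `G * 𝒜 = {(γ, e) : s(γ) = p(e)}` to `𝒜`. -/
structure GroupoidAction (c : C0Algebra (UnitSpace G) A) where
  α : ∀ γ : G, c.Fiber (sU γ) ≃⋆ₐ[ℂ] c.Fiber (rU γ)
  α_comp : ∀ (γ η : G) (h : s γ = r η) (e : c.TotalSpace) (he : e.base = sU η),
    arrowAct c α (comp γ η h) e (he.trans (Subtype.ext (s_comp γ η h).symm)) =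
      arrowAct c α γ (arrowAct c α η e he) (Subtype.ext h.symm)
  continuous_α : Continuous fun p : {p : G × c.TotalSpace // p.2.base = sU p.1} =>
    arrowAct c α p.1.1 p.1.2 p.2

/-- The ideal `I` is `G`-invariant: `α_γ(ℐ_{s(γ)}) = ℐ_{r(γ)}` for all `γ`, where `ℐ_u` is
regarded as a subset of `𝒜_u` through the map of fibres induced by the inclusion of `I`. -/
def GroupoidAction.IsInvariant {c : C0Algebra (UnitSpace G) A} (α : GroupoidAction c)
    (I : ClosedIdeal A) : Prop :=
  ∀ γ : G, α.α γ '' Set.range ((c.ι I).fiberMap (sU γ)) = Set.range ((c.ι I).fiberMap (rU γ))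

end Groupoid

end PullbackExact

end

open PullbackExact

noncomputable section

namespace PullbackExact

/-! ### Homomorphisms of C⋆-algebras -/

section Hom

variable {B C : Type*} [NonUnitalCStarAlgebra B] [NonUnitalCStarAlgebra C]

/-! Exactness is first a statement about fibres, and sections then carry it over. Over a point `x`,
an approximate unit of `I` shows that an element of `I` vanishing at `x` in `A` already vanishes at
`x` in `I` (`mem_vanishIdeal_ideal`). Hence `I_x → A_x` is injective, and therefore isometric.
Quotient norms show that everything killed by `A_x → (A/I)_x` is a limit of values of elements of
`I` (`mem_range_fiberMap_ι`). The range of a ⋆-homomorphism is closed (`isClosed_range_starHom`), so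
these limits are attained.

Injectivity of `ρ⋆ι` is then pointwise. For exactness in the middle, a section killed by `ρ⋆q` lifts
uniquely, fibre by fibre, to a section of the bundle of `I`. Isometry of the fibre inclusions
transfers both continuity and decay at infinity to the lift (`pullback_exact`). Surjectivity of
`ρ⋆q` is not pointwise, since a fibrewise lift need not be continuous. Instead, finite sums of
sections `φ ⊗ b` are dense, by a partition of unity (`exists_sum_tensor_near`). Each of them lifts
by lifting `b`, and the range is closed (`pullback_surjective`).

Bump functions and partitions of unity on `X/H` require it to be locally compact Hausdorff. The Haar
system on `H` makes the range map of `H` open (`HaarSystem.isOpenMap_rU`), so the orbit map is open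
(`isOpenQuotientMap_mk`). The orbit relation is closed because it is the condition `γ⁻¹γ' ∈ H`
(`isClosed_orbit_rel`). -/

theorem continuous_starHom (π : B →⋆ₙₐ[ℂ] C) : Continuous π :=
  AddMonoidHomClass.continuous_of_bound π 1 fun a => by
    rw [one_mul]; exact NonUnitalStarAlgHom.norm_apply_le π a

/-- The kernel of a ⋆-homomorphism. -/
def kerIdeal (π : B →⋆ₙₐ[ℂ] C) : ClosedIdeal B where
  toSubmodule := LinearMap.ker (LinearMapClass.linearMap π)
  mul_mem_left' b a ha := by
    change π (b * a) = 0
    rw [map_mul, show π a = 0 from ha, mul_zero]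
  mul_mem_right' b a ha := by
    change π (a * b) = 0
    rw [map_mul, show π a = 0 from ha, zero_mul]
  isClosed' := isClosed_singleton.preimage (continuous_starHom π)

/-- The injection of `B / ker π` into `C` induced by `π : B → C`. -/
def kerLift (π : B →⋆ₙₐ[ℂ] C) : (kerIdeal π).Quot →⋆ₙₐ[ℂ] C where
  toFun := Submodule.liftQ (kerIdeal π).toSubmodule (LinearMapClass.linearMap π) le_rfl
  map_smul' z e := map_smul (Submodule.liftQ (kerIdeal π).toSubmodule _ _) z e
  map_zero' := map_zero (Submodule.liftQ (kerIdeal π).toSubmodule _ _)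
  map_add' e e' := map_add (Submodule.liftQ (kerIdeal π).toSubmodule _ _) e e'
  map_mul' e e' := by
    obtain ⟨a, rfl⟩ := (kerIdeal π).proj_surj e
    obtain ⟨a', rfl⟩ := (kerIdeal π).proj_surj e'
    exact map_mul π a a'
  map_star' e := by
    obtain ⟨a, rfl⟩ := (kerIdeal π).proj_surj e
    exact map_star π a

theorem kerLift_proj (π : B →⋆ₙₐ[ℂ] C) (a : B) : kerLift π ((kerIdeal π).proj a) = π a := rfl

theorem kerLift_injective (π : B →⋆ₙₐ[ℂ] C) : Function.Injective (kerLift π) := by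
  refine (injective_iff_map_eq_zero _).2 fun e he => ?_
  obtain ⟨a, rfl⟩ := (kerIdeal π).proj_surj e
  exact (kerIdeal π).proj_eq_zero.2 he

/-- The range of a ⋆-homomorphism of C⋆-algebras is closed. -/
theorem isClosed_range_starHom (π : B →⋆ₙₐ[ℂ] C) : IsClosed (Set.range π) := by
  have h : Set.range π = Set.range (kerLift π) := by
    ext x
    constructor
    · rintro ⟨a, rfl⟩
      exact ⟨_, kerLift_proj π a⟩
    · rintro ⟨e, rfl⟩
      obtain ⟨a, rfl⟩ := (kerIdeal π).proj_surj e
      exact ⟨a, rfl⟩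
  rw [h]
  -- An injective ⋆-homomorphism of C⋆-algebras is isometric, so its range is complete.
  exact (NonUnitalStarAlgHom.isometry _ (kerLift_injective π)).isClosedEmbedding.isClosed_range

end Hom

/-! ### Fibres of ideals and quotients -/

section Fibres

variable {X : Type*} [TopologicalSpace X] {B : Type*} [NonUnitalCStarAlgebra B]
  (c : C0Algebra X B) (I : ClosedIdeal B)

/-- Multiplying by an approximate unit `e` of `I` pushes approximants from `B` into `I`: since `(φ ·
b)e = φ · (be)`, the coefficient `φ` vanishing at `x` survives. This is what makes the fibres of `I`
ideals in the fibres of `B`. -/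
theorem mem_vanishIdeal_ideal {x : X} {a : I} (ha : (a : B) ∈ c.vanishIdeal x) :
    a ∈ (c.ideal I).vanishIdeal x := by
  refine Metric.mem_closure_iff.2 fun ε hε => ?_
  obtain ⟨e, he, hs, hcon, hlt⟩ := I.exists_approx a.2 (ε := ε / 2) (by positivity)
  -- The crude factor 2 comes from contractivity of `b ↦ b - be`, and explains the tolerance `ε / 4`
  -- below.
  have hcon' : ∀ b : B, ‖b * e‖ ≤ 2 * ‖b‖ := fun b => by
    have := hcon (star b)
    rw [← norm_star, star_sub, star_mul, star_star, hs, norm_star] at this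
    have h2 : b * e = b - (b - b * e) := by abel
    rw [h2]
    linarith [norm_sub_le b (b - b * e)]
  obtain ⟨b, hb, hab⟩ := Metric.mem_closure_iff.1 ha (ε / 4) (by positivity)
  refine ⟨⟨b * e, I.mul_mem_left _ he⟩, ?_, ?_⟩
  · clear hab
    refine Submodule.span_induction
      (p := fun b _ => (⟨b * e, I.mul_mem_left b he⟩ : I) ∈ (c.ideal I).vanishSpan x)
      ?_ ?_ ?_ ?_ hb
    · rintro _ ⟨φ, b, h0, rfl⟩
      exact Submodule.subset_span ⟨φ, ⟨b * e, I.mul_mem_left b he⟩, h0,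
        Subtype.ext (c.act_mul_right φ b e).symm⟩
    · convert Submodule.zero_mem _ using 1
      exact Subtype.ext (zero_mul e)
    · intro x y _ _ hx hy
      convert Submodule.add_mem _ hx hy using 1
      exact Subtype.ext (add_mul x y e)
    · intro z x _ hx
      convert Submodule.smul_mem _ z hx using 1
      exact Subtype.ext (smul_mul_assoc z x e)
  · rw [dist_eq_norm] at hab ⊢
    change ‖(a : B) - b * e‖ < ε
    have h3 : (a : B) - b * e = (a - a * e) + (a - b) * e := by noncomm_ring
    rw [h3]
    linarith [norm_add_le ((a : B) - a * e) ((a - b) * e), hcon' (a - b)]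

theorem fiberMap_ι_injective (x : X) : Function.Injective ((c.ι I).fiberMap x) := by
  refine (injective_iff_map_eq_zero _).2 fun e he => ?_
  obtain ⟨a, rfl⟩ := (c.ideal I).eval_surj x e
  exact ((c.ideal I).vanishIdeal x).proj_eq_zero.2
    (mem_vanishIdeal_ideal c I ((c.vanishIdeal x).proj_eq_zero.1 he))

theorem norm_fiberMap_ι (x : X) (e : (c.ideal I).Fiber x) : ‖(c.ι I).fiberMap x e‖ = ‖e‖ :=
  NonUnitalStarAlgHom.norm_map _ (fiberMap_ι_injective c I x) e

theorem fiberMap_q_ι (x : X) (e : (c.ideal I).Fiber x) :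
    (c.q I).fiberMap x ((c.ι I).fiberMap x e) = 0 := by
  obtain ⟨a, rfl⟩ := (c.ideal I).eval_surj x e
  have h : I.proj (a : B) = 0 := I.proj_eq_zero.2 a.2
  have h2 : (c.q I).fiberMap x ((c.ι I).fiberMap x ((c.ideal I).eval x a)) =
    (c.quot I).eval x (I.proj (a : B)) := rfl
  rw [h2, h, map_zero]

/-- The lift is made on the algebraic span, where generators `φ · b` lift with the same `φ`; passing
to the closure is left to the caller. -/
theorem exists_vanishSpan_lift {x : X} {b : I.Quot} (hb : b ∈ (c.quot I).vanishSpan x) :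
    ∃ a ∈ c.vanishSpan x, I.proj a = b := by
  refine Submodule.span_induction
    (p := fun b _ => ∃ a ∈ c.vanishSpan x, I.proj a = b) ?_ ?_ ?_ ?_ hb
  · rintro _ ⟨φ, b, h0, rfl⟩
    obtain ⟨a, rfl⟩ := I.proj_surj b
    exact ⟨act c.Φ φ a, Submodule.subset_span ⟨φ, a, h0, rfl⟩, rfl⟩
  · exact ⟨0, Submodule.zero_mem _, map_zero _⟩
  · rintro _ _ _ _ ⟨a, ha, rfl⟩ ⟨a', ha', rfl⟩
    exact ⟨a + a', Submodule.add_mem _ ha ha', map_add _ _ _⟩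
  · rintro z _ _ ⟨a, ha, rfl⟩
    exact ⟨z • a, Submodule.smul_mem _ z ha, map_smul _ _ _⟩

/-- Closedness of the range reduces this to approximation. If `q(a)` is near `q(a')` with `a'`
vanishing at `x`, then `a - a'` lies in `I` up to a small error, and `a'` does not contribute to the
value at `x`. -/
theorem mem_range_fiberMap_ι {x : X} {e : c.Fiber x} (he : (c.q I).fiberMap x e = 0) :
    e ∈ Set.range ((c.ι I).fiberMap x) := by
  rw [← (isClosed_range_starHom ((c.ι I).fiberMap x)).closure_eq]
  refine Metric.mem_closure_iff.2 fun ε hε => ?_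
  obtain ⟨a, rfl⟩ := c.eval_surj x e
  have ha : I.proj a ∈ (c.quot I).vanishIdeal x := ((c.quot I).vanishIdeal x).proj_eq_zero.1 he
  obtain ⟨b, hb, hab⟩ := Metric.mem_closure_iff.1 ha ε hε
  obtain ⟨a', ha', rfl⟩ := exists_vanishSpan_lift c I hb
  rw [dist_eq_norm, ← map_sub] at hab
  -- A representative of the class of `a - a'` with norm below `ε`; the slack used is exactly `ε -
  -- ‖q(a - a')‖`.
  obtain ⟨d, hd, hlt⟩ := I.exists_norm_lt (I.proj (a - a')) (sub_pos.2 hab)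
  have hj : a - a' - d ∈ I := I.mkₗ_eq.1 hd.symm
  refine ⟨_, ⟨(c.ideal I).eval x ⟨_, hj⟩, rfl⟩, ?_⟩
  have h0 : c.eval x a' = 0 :=
    (c.vanishIdeal x).proj_eq_zero.2 (subset_closure ha')
  have h1 : (c.ι I).fiberMap x ((c.ideal I).eval x ⟨_, hj⟩) = c.eval x (a - a' - d) := rfl
  rw [dist_eq_norm, h1, ← map_sub, show a - (a - a' - d) = a' + d by abel, map_add, h0, zero_add]
  linarith [c.norm_eval_le x d]

end Fibres

/-! ### Exactness of the pullback -/

section Pullback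

variable {X : Type*} [TopologicalSpace X] {B : Type*} [NonUnitalCStarAlgebra B]
  (c : C0Algebra X B) {Y : Type*} [TopologicalSpace Y] (ρ : C(Y, X))

/-- A compactly supported real function as an element of `C₀(Y)`. -/
def toC0 (f : C(Y, ℝ)) (hf : HasCompactSupport f) : C₀(Y, ℂ) where
  toFun y := (f y : ℂ)
  continuous_toFun := Complex.continuous_ofReal.comp f.continuous
  zero_at_infty' := HasCompactSupport.is_zero_at_infty
    (f := fun y => (f y : ℂ)) (hf.comp_left (g := ((↑) : ℝ → ℂ)) Complex.ofReal_zero)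

/-- Centrality holds because pointwise multiplication acts identically from both sides. For
nondegeneracy, a section is approximated by its product with a cutoff equal to 1 on the compact set
where it is large. -/
theorem isC0Algebra_pullbackΦ [T2Space Y] [LocallyCompactSpace Y] :
    IsC0Algebra (c.pullbackΦ ρ) := by
  refine ⟨fun φ => mem_center_of_fst_eq_snd _ fun a => rfl, fun f => ?_⟩
  refine Metric.mem_closure_iff.2 fun ε hε => ?_
  obtain ⟨u, hu1, -, hus, hu⟩ := exists_continuous_one_zero_of_isCompact
    (f.2.vanish (ε / 2) (by positivity)) isClosed_empty (Set.disjoint_empty _)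
  refine ⟨_, Submodule.subset_span ⟨toC0 u hus, f, rfl⟩, ?_⟩
  rw [dist_eq_norm]
  refine (c.norm_pullback_le ρ (half_pos hε).le fun y => ?_).trans_lt (half_lt_self hε)
  have h1 : (f - act (c.pullbackΦ ρ) (toC0 u hus) f).1 y = ((1 - u y : ℝ) : ℂ) • f.1 y := by
    push_cast
    rw [sub_smul, one_smul]
    rfl
  rw [h1]
  by_cases hy : ε / 2 ≤ ‖f.1 y‖
  · rw [show u y = 1 from hu1 hy]
    simpa using (half_pos hε).le
  · rw [norm_smul, Complex.norm_real, Real.norm_eq_abs, abs_of_nonneg (by linarith [(hu y).2])]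
    nlinarith [(hu y).1, norm_nonneg (f.1 y)]

/-- The section `φ ⊗ b : y ↦ φ(y) b(ρ(y))` is continuous and vanishes at infinity. -/
theorem isC0Section_tensor (φ : C₀(Y, ℂ)) (b : B) :
    c.IsC0Section ρ fun y => φ y • c.eval (ρ y) b := by
  have hcont : Continuous (c.sectionMap ρ fun y => φ y • c.eval (ρ y) b) := by
    rw [C0Algebra.continuous_section_iff]
    intro y ε hε
    -- Freezing the coefficient at `y` gives the local approximant. The `+ 1` in the tolerance
    -- allows `b = 0`.
    refine ⟨φ y • b, ?_⟩
    have hφ := Metric.tendsto_nhds.1 ((map_continuous φ).tendsto y) (ε / (‖b‖ + 1))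
      (by positivity)
    filter_upwards [hφ] with z hz
    rw [dist_eq_norm, lt_div_iff₀ (by positivity)] at hz
    rw [map_smul, ← sub_smul, norm_smul]
    nlinarith [c.norm_eval_le (ρ z) b, norm_nonneg (φ z - φ y)]
  refine ⟨hcont, fun ε hε => ?_⟩
  have h0 := Metric.tendsto_nhds.1 (zero_at_infty φ) (ε / (‖b‖ + 1)) (by positivity)
  obtain ⟨K, hK, hKs⟩ := Filter.mem_cocompact.1 h0
  refine hK.of_isClosed_subset (c.isClosed_norm_ge ρ hcont ε) fun y hy => ?_
  by_contra hyK
  have h1 : dist (φ y) 0 < ε / (‖b‖ + 1) := hKs hyK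
  rw [dist_zero_right, lt_div_iff₀ (by positivity)] at h1
  have h2 : ε ≤ ‖φ y • c.eval (ρ y) b‖ := hy
  rw [norm_smul] at h2
  nlinarith [c.norm_eval_le (ρ y) b, norm_nonneg (φ y)]

/-- The section `φ ⊗ b : y ↦ φ(y) b(ρ(y))`. -/
def tensor (φ : C₀(Y, ℂ)) (b : B) : c.pullback ρ :=
  c.mkSection ρ _ (isC0Section_tensor c ρ φ b) (C := ‖φ‖ * ‖b‖) fun y => by
    rw [norm_smul]
    exact mul_le_mul (C0Algebra.norm_C0_apply_le φ y) (c.norm_eval_le _ _) (norm_nonneg _)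
      (norm_nonneg _)

theorem tensor_apply (φ : C₀(Y, ℂ)) (b : B) (y : Y) :
    (tensor c ρ φ b).1 y = φ y • c.eval (ρ y) b := rfl

theorem sum_tensor_apply {κ : Type*} (t : Finset κ) (φ : κ → C₀(Y, ℂ)) (b : κ → B) (y : Y) :
    (∑ i ∈ t, tensor c ρ (φ i) (b i)).1 y = ∑ i ∈ t, φ i y • c.eval (ρ y) (b i) := by
  classical
  induction t using Finset.induction_on with
  | empty => rfl
  | insert i t hi ih =>
    rw [Finset.sum_insert hi, Finset.sum_insert hi, ← ih]
    rfl

/-- Sums of sections `φ ⊗ b` are dense in `ρ⋆B`. -/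
theorem exists_sum_tensor_near [T2Space Y] [LocallyCompactSpace Y] (g : c.pullback ρ) {ε : ℝ}
    (hε : 0 < ε) : ∃ (t : Finset Y) (φ : t → C₀(Y, ℂ)) (b : t → B),
      ‖g - ∑ i, tensor c ρ (φ i) (b i)‖ < ε := by
  have hK := g.2.vanish (ε / 3) (by positivity)
  have hloc : ∀ y, ∃ b, ∀ᶠ z in 𝓝 y, ‖g.1 z - c.eval (ρ z) b‖ < ε / 3 := fun y =>
    (c.continuous_section_iff ρ _).1 g.2.continuous y (ε / 3) (by positivity)
  choose b hb using hloc
  have hU : ∀ y, ∃ U, (∀ z ∈ U, ‖g.1 z - c.eval (ρ z) (b y)‖ < ε / 3) ∧ IsOpen U ∧ y ∈ U :=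
    fun y => eventually_nhds_iff.1 (hb y)
  choose U hUb hUo hUy using hU
  obtain ⟨t, ht⟩ := hK.elim_finite_subcover U hUo fun y _ => Set.mem_iUnion.2 ⟨y, hUy y⟩
  -- The functions sum to 1 on the compact set where `‖g‖ ≥ ε / 3`. Elsewhere the sum is only known
  -- to be at most 1, but there `g` is small.
  obtain ⟨p, hp, hpc⟩ := PartitionOfUnity.exists_isSubordinate_of_locallyFinite_t2space hK
    (fun i : t => U i) (fun i => hUo i) (locallyFinite_of_finite _)
    (fun y hy => by simpa using ht hy)
  refine ⟨t, fun i => toC0 (p i) (hpc i), fun i => b i, ?_⟩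
  refine (c.norm_pullback_le ρ (C := 2 * (ε / 3)) (by positivity) fun y => ?_).trans_lt
    (by linarith)
  have hle : ∑ i, p i y ≤ 1 := by
    rw [← finsum_eq_sum_of_fintype]; exact p.sum_le_one y
  -- Splits the error into `(1 - ∑ pᵢ) g` and `∑ pᵢ (g - bᵢ)`. Each is at most `ε / 3`: the first
  -- vanishes where `g` is large, the second is controlled on the support of each `pᵢ`.
  have h1 : (g - ∑ i : t, tensor c ρ (toC0 (p i) (hpc i)) (b i)).1 y =
      ((1 - ∑ i, p i y : ℝ) : ℂ) • g.1 y +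
        ∑ i : t, ((p i y : ℝ) : ℂ) • (g.1 y - c.eval (ρ y) (b i)) := by
    have h2 : (g - ∑ i : t, tensor c ρ (toC0 (p i) (hpc i)) (b i)).1 y =
      g.1 y - (∑ i : t, tensor c ρ (toC0 (p i) (hpc i)) (b i)).1 y := rfl
    rw [h2, sum_tensor_apply]
    push_cast
    rw [sub_smul, one_smul, Finset.sum_smul]
    simp only [smul_sub, Finset.sum_sub_distrib]
    simp only [toC0, ZeroAtInftyContinuousMap.coe_mk]
    abel
  rw [h1]
  refine (norm_add_le _ _).trans ?_
  have h3 : ‖((1 - ∑ i, p i y : ℝ) : ℂ) • g.1 y‖ ≤ ε / 3 := by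
    rw [norm_smul, Complex.norm_real, Real.norm_eq_abs, abs_of_nonneg (by linarith)]
    by_cases hy : ε / 3 ≤ ‖g.1 y‖
    · have : ∑ i, p i y = 1 := by
        rw [← finsum_eq_sum_of_fintype]; exact p.sum_eq_one hy
      rw [this, sub_self, zero_mul]
      positivity
    · have h0 : 0 ≤ ∑ i, p i y := Finset.sum_nonneg fun i _ => p.nonneg i y
      nlinarith [norm_nonneg (g.1 y)]
  have h4 : ‖∑ i : t, ((p i y : ℝ) : ℂ) • (g.1 y - c.eval (ρ y) (b i))‖ ≤ ε / 3 := by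
    calc _ ≤ ∑ i : t, p i y * (ε / 3) := by
          refine norm_sum_le_of_le _ fun i _ => ?_
          rw [norm_smul, Complex.norm_real, Real.norm_eq_abs, abs_of_nonneg (p.nonneg i y)]
          by_cases hy : y ∈ U i
          · exact mul_le_mul_of_nonneg_left (hUb i y hy).le (p.nonneg i y)
          · have : p i y = 0 := by
              by_contra h
              exact hy (hp i (subset_tsupport _ h))
            rw [this, zero_mul, zero_mul]
      _ = (∑ i, p i y) * (ε / 3) := (Finset.sum_mul _ _ _).symm
      _ ≤ 1 * (ε / 3) := by gcongr
      _ = ε / 3 := one_mul _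
  linarith

/-- The range is closed and contains every `φ ⊗ ψ(a)`, being the image of `φ ⊗ a`; when `ψ` is onto,
sums of these are dense. -/
theorem pullback_surjective [T2Space Y] [LocallyCompactSpace Y] {C : Type*}
    [NonUnitalCStarAlgebra C] {c : C0Algebra X B} {d : C0Algebra X C} (ψ : C0Hom c d)
    (hψ : Function.Surjective ψ.toNonUnitalStarAlgHom) : Function.Surjective (ψ.pullback ρ) := by
  intro g
  change g ∈ Set.range (ψ.pullback ρ)
  rw [← (isClosed_range_starHom (ψ.pullback ρ)).closure_eq]
  refine Metric.mem_closure_iff.2 fun ε hε => ?_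
  obtain ⟨t, φ, b, hlt⟩ := exists_sum_tensor_near d ρ g hε
  choose a ha using fun i => hψ (b i)
  refine ⟨_, ⟨∑ i, tensor c ρ (φ i) (a i), rfl⟩, ?_⟩
  have h : ∀ i, ψ.pullback ρ (tensor c ρ (φ i) (a i)) = tensor d ρ (φ i) (b i) := fun i =>
    d.pullback_ext ρ fun y => by
      rw [C0Hom.pullback_apply, tensor_apply, tensor_apply, map_smul, C0Hom.fiberMap_eval, ha]
  rwa [map_sum, Finset.sum_congr rfl fun i _ => h i, dist_eq_norm]

theorem pullback_ι_injective (I : ClosedIdeal B) : Function.Injective ((c.ι I).pullback ρ) := by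
  intro f g h
  refine (c.ideal I).pullback_ext ρ fun y => fiberMap_ι_injective c I (ρ y) ?_
  rw [← C0Hom.pullback_apply, h, C0Hom.pullback_apply]

/-- Fibrewise exactness produces the lift as a bare family of fibre elements. That it is a
continuous section vanishing at infinity follows because the fibre inclusions preserve norms. -/
theorem pullback_exact (I : ClosedIdeal B) :
    Function.Exact ((c.ι I).pullback ρ) ((c.q I).pullback ρ) := by
  intro f
  constructor
  · intro hf
    have h0 : ∀ y, (c.q I).fiberMap (ρ y) (f.1 y) = 0 := fun y => by
      rw [← C0Hom.pullback_apply, hf]; rfl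
    choose g hg using fun y => mem_range_fiberMap_ι c I (h0 y)
    have hn : ∀ y, ‖g y‖ = ‖f.1 y‖ := fun y => by rw [← hg, norm_fiberMap_ι]
    have hgs : (c.ideal I).IsC0Section ρ g := by
      refine ⟨?_, fun ε hε => by simpa only [hn] using f.2.vanish ε hε⟩
      rw [C0Algebra.continuous_section_iff]
      intro y ε hε
      obtain ⟨a, ha⟩ := (c.ideal I).eval_surj (ρ y) (g y)
      -- The distance from `g` to the section of `a ∈ I` can be measured in the larger bundle, where
      -- continuity of `f` makes it small near `y`.
      have key : ∀ z, ‖g z - (c.ideal I).eval (ρ z) a‖ = ‖f.1 z - c.eval (ρ z) (a : B)‖ :=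
        fun z => by
          rw [← norm_fiberMap_ι, map_sub, hg]; rfl
      refine ⟨a, ?_⟩
      simp only [key]
      refine (c.continuous_section_iff' ρ _).1 f.2.continuous y a ε ?_
      rw [← key, ha, sub_self, norm_zero]
      exact hε
    refine ⟨(c.ideal I).mkSection ρ g hgs (C := ‖f‖)
      fun y => (hn y).le.trans (c.norm_apply_le ρ f y), ?_⟩
    exact c.pullback_ext ρ hg
  · rintro ⟨g, rfl⟩
    exact (c.quot I).pullback_ext ρ fun y => fiberMap_q_ι c I (ρ y) (g.1 y)

end Pullback

/-! ### The orbit space -/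

section OrbitSpace

open TopologicalGroupoid MeasureTheory

variable {G : Type*} [TopologicalSpace G] [TopologicalGroupoid G]

theorem continuous_s : Continuous (s : G → G) := by
  have h : (s : G → G) = r ∘ inv := funext fun γ => (r_inv γ).symm
  rw [h]
  exact continuous_r.comp continuous_inv'

/-- The range map of a groupoid with a Haar system is open. -/
theorem HaarSystem.isOpenMap_rU [T2Space G] [LocallyCompactSpace G] [MeasurableSpace G]
    [BorelSpace G] (haar : HaarSystem G) : IsOpenMap (rU : G → UnitSpace G) := by
  refine isOpenMap_iff_nhds_le.2 fun γ V hV => ?_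
  obtain ⟨W, hWV, hWo, hγW⟩ := mem_nhds_iff.1 (Filter.mem_map.1 hV)
  obtain ⟨f, hf1, hf0, hfs, hf⟩ := exists_continuous_one_zero_of_isCompact
    (isCompact_singleton (x := γ)) hWo.isClosed_compl
    (Set.disjoint_compl_right_iff_subset.2 (Set.singleton_subset_iff.2 hγW))
  have hfγ : f γ = 1 := hf1 rfl
  have hcont := haar.continuous_integral (fun η => (f η : ℂ))
    (Complex.continuous_ofReal.comp f.continuous) (hfs.comp_left (g := ((↑) : ℝ → ℂ)) (by simp))
  simp only [integral_complex_ofReal] at hcont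
  -- The bump `f` is positive near `γ`, which lies in the support of the measure over its own range.
  have hne : ∫ η, f η ∂haar.measure (rU γ) ≠ 0 := by
    have := haar.regular (rU γ)
    have hmem : γ ∈ (haar.measure (rU γ)).support := by
      rw [haar.support_eq]; rfl
    refine ((integral_pos_iff_support_of_nonneg (fun η => (hf η).1)
      (f.continuous.integrable_of_hasCompactSupport hfs)).2 ?_).ne'
    refine Measure.mem_support_iff_forall γ |>.1 hmem _ ?_
    refine (isOpen_ne_fun f.continuous continuous_const).mem_nhds ?_
    change f γ ≠ 0
    rw [hfγ]; exact one_ne_zero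
  have hev := (hcont.continuousAt (x := rU γ)).eventually_ne (Complex.ofReal_ne_zero.2 hne)
  filter_upwards [hev] with u hu
  -- Were `u` outside `V`, the fibre `r⁻¹(u)`, which carries the measure, would miss `W`; then `f`
  -- vanishes on it and the integral is zero.
  by_contra huV
  refine hu ?_
  norm_cast
  have := haar.regular u
  refine integral_eq_zero_of_ae ?_
  filter_upwards [Measure.support_mem_ae_of_regular (μ := haar.measure u)] with η hη
  rw [haar.support_eq] at hη
  by_contra h
  have hηW : η ∈ W := by
    by_contra hW
    exact h (hf0 hW)
  refine huV ?_
  have : rU η = u := Subtype.ext hη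
  rw [← this]
  exact hWV hηW

/-! ### Closed orbit relation, open orbit map, and separation of the orbit space -/

namespace ClosedSubgroupoid

variable (H : ClosedSubgroupoid G)

theorem isClosed : IsClosed (H : Set G) := H.isClosed'

/-- Composability is a proof argument of `comp`, so factors cannot be rewritten in place; this
transports it. -/
theorem comp_eq_comp {γ γ' η η' : G} (hγ : γ = γ') (hη : η = η') (h : s γ = r η) :
    comp γ η h = comp γ' η' (by rw [← hγ, ← hη, h]) := by
  subst hγ hη
  rfl

theorem inv_comp_cancel_left {γ η : G} (h : s γ = r η) :
    comp (inv γ) (comp γ η h) ((s_inv γ).trans (r_comp γ η h).symm) = η := by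
  rw [← assoc (inv γ) γ η (s_inv γ) h, comp_eq_comp ((inv_comp γ).trans h) rfl, unit_comp]

theorem comp_inv_cancel_left {γ γ' : G} (h : r γ = r γ') :
    comp γ (comp (inv γ) γ' ((s_inv γ).trans h)) ((r_inv γ).symm.trans (r_comp _ _ _).symm) =
      γ' := by
  rw [← assoc γ (inv γ) γ' (r_inv γ).symm ((s_inv γ).trans h),
    comp_eq_comp ((comp_inv γ).trans h) rfl, unit_comp]

/-- The arrow `η` with `γ' = γη` can only be `γ⁻¹γ'`. This removes the existential and leaves a
membership condition on a continuous function of the pair. -/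
theorem orbit_rel_iff (γ γ' : H.SourceSpace) : H.orbitSetoid γ γ' ↔
    ∃ h : r γ.1 = r γ'.1, comp (inv γ.1) γ'.1 ((s_inv _).trans h) ∈ H := by
  constructor
  · rintro ⟨η, hη, h, e⟩
    refine ⟨by rw [e, r_comp], ?_⟩
    rwa [comp_eq_comp rfl e, inv_comp_cancel_left]
  · rintro ⟨h, hη⟩
    exact ⟨_, hη, (r_inv _).symm.trans (r_comp _ _ _).symm, (comp_inv_cancel_left h).symm⟩

/-- On the closed set of pairs with equal range, the relation is the preimage of the closed set `H`
under `(γ, γ') ↦ γ⁻¹γ'`. -/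
theorem isClosed_orbit_rel [T2Space G] :
    IsClosed {p : H.SourceSpace × H.SourceSpace | H.orbitSetoid p.1 p.2} := by
  have hcl : IsClosed {p : H.SourceSpace × H.SourceSpace | r p.1.1 = r p.2.1} :=
    isClosed_eq (continuous_r.comp (continuous_subtype_val.comp continuous_fst))
      (continuous_r.comp (continuous_subtype_val.comp continuous_snd))
  let F : {p : H.SourceSpace × H.SourceSpace | r p.1.1 = r p.2.1} → G := fun p =>
    comp (inv p.1.1.1) p.1.2.1 ((s_inv _).trans p.2)
  have hF : Continuous F := by
    have h : Continuous fun p : {p : H.SourceSpace × H.SourceSpace | r p.1.1 = r p.2.1} =>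
        (⟨(inv p.1.1.1, p.1.2.1), (s_inv _).trans p.2⟩ : {p : G × G // s p.1 = r p.2}) :=
      Continuous.subtype_mk ((continuous_inv'.comp (by fun_prop)).prodMk (by fun_prop)) _
    exact continuous_comp'.comp h
  have := hcl.isClosedEmbedding_subtypeVal.isClosedMap _ (H.isClosed.preimage hF)
  convert this using 1
  ext ⟨γ, γ'⟩
  change H.orbitSetoid γ γ' ↔ _
  rw [orbit_rel_iff]
  constructor
  · rintro ⟨h, hm⟩
    exact ⟨⟨(γ, γ'), h⟩, hm, rfl⟩
  · rintro ⟨⟨_, h⟩, hm, rfl⟩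
    exact ⟨h, hm⟩

variable {H}

/-- The orbit map `X → X/H` is open when the range map of `H` is. -/
theorem isOpenQuotientMap_mk (hr : IsOpenMap (rU : H → UnitSpace H)) :
    IsOpenQuotientMap (Quotient.mk H.orbitSetoid : H.SourceSpace → H.OrbitSpace) := by
  refine ⟨Quotient.mk_surjective, continuous_quotient_mk', fun U hU => ?_⟩
  change IsOpen (Quotient.mk H.orbitSetoid ⁻¹' _)
  rw [isOpen_iff_mem_nhds]
  rintro ξ ⟨γ, hγ, hγξ⟩
  obtain ⟨η, hη, h, e⟩ := H.orbitSetoid.symm (Quotient.exact hγξ)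
  obtain ⟨W, hW, rfl⟩ := isOpen_induced_iff.1 hU
  have hpre := hW.preimage (continuous_comp' (G := G))
  obtain ⟨O, hO, hOeq⟩ := isOpen_induced_iff.1 hpre
  have hmem : (ξ.1, η) ∈ O := by
    have : (⟨(ξ.1, η), h⟩ : {p : G × G // s p.1 = r p.2}) ∈ Subtype.val ⁻¹' O := by
      rw [hOeq]
      change comp ξ.1 η h ∈ W
      rw [← e]; exact hγ
    exact this
  -- Composable products from the box `V₁ × V₂` around `(ξ, η)` stay in `W`.
  obtain ⟨V₁, V₂, hV₁, hV₂, hξ, hηV, hsub⟩ := isOpen_prod_iff.1 hO _ _ hmem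
  have hS : Continuous fun ξ : H.SourceSpace => (⟨⟨s ξ.1, ξ.2⟩, Subtype.ext (r_s _)⟩ :
      UnitSpace H) :=
    ((continuous_s.comp continuous_subtype_val).subtype_mk _).subtype_mk _
  -- Openness of the range map of `H` enters here: for every `ζ` near `ξ` there is `θ ∈ V₂ ∩ H` with
  -- `r(θ) = s(ζ)`, so `ζθ` is a point of the given open set in the orbit of `ζ`.
  have hN := (hr _ (hV₂.preimage continuous_subtype_val)).preimage hS
  have hNξ : ξ ∈ (fun ξ : H.SourceSpace => (⟨⟨s ξ.1, ξ.2⟩, Subtype.ext (r_s _)⟩ :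
      UnitSpace H)) ⁻¹' (rU '' (Subtype.val ⁻¹' V₂ : Set H)) :=
    ⟨⟨η, hη⟩, hηV, Subtype.ext (Subtype.ext h.symm)⟩
  filter_upwards [hN.mem_nhds hNξ, (hV₁.preimage continuous_subtype_val).mem_nhds hξ]
    with ζ hζ hζ1
  obtain ⟨⟨θ, hθ⟩, hθV, hθe⟩ := hζ
  have hsr : s ζ.1 = r θ := (congrArg (fun u : UnitSpace H => (u.1 : G)) hθe).symm
  have hmemW : comp ζ.1 θ hsr ∈ W := by
    have : (⟨(ζ.1, θ), hsr⟩ : {p : G × G // s p.1 = r p.2}) ∈ Subtype.val ⁻¹' O :=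
      hsub (Set.mk_mem_prod hζ1 hθV)
    rw [hOeq] at this
    exact this
  have hs : s (comp ζ.1 θ hsr) ∈ H := by
    rw [s_comp]; exact H.s_mem hθ
  refine ⟨⟨_, hs⟩, hmemW, ?_⟩
  exact Quotient.sound (H.orbitSetoid.symm ⟨θ, hθ, hsr, rfl⟩)

theorem t2Space_orbitSpace [T2Space G] (hr : IsOpenMap (rU : H → UnitSpace H)) :
    T2Space H.OrbitSpace := by
  refine (t2Space_iff_of_isOpenQuotientMap (isOpenQuotientMap_mk hr)).2 ?_
  convert H.isClosed_orbit_rel using 1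
  ext p
  exact Quotient.eq

theorem locallyCompactSpace_orbitSpace [LocallyCompactSpace G]
    (hr : IsOpenMap (rU : H → UnitSpace H)) : LocallyCompactSpace H.OrbitSpace := by
  have hX : IsClosed {γ : G | s γ ∈ H} := H.isClosed.preimage continuous_s
  have : LocallyCompactSpace H.SourceSpace := hX.isClosedEmbedding_subtypeVal.locallyCompactSpace
  exact (isOpenQuotientMap_mk hr).locallyCompactSpace

end ClosedSubgroupoid

end OrbitSpace

end PullbackExact

end

open PullbackExact
theorem mainTheorem6
    {G : Type*} [TopologicalSpace G] [T2Space G] [LocallyCompactSpace G]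
    [SecondCountableTopology G] [MeasurableSpace G] [BorelSpace G] [TopologicalGroupoid G]
    (haarG : HaarSystem G)
    (H : ClosedSubgroupoid G) (haarH : HaarSystem H)
    {A : Type*} [NonUnitalCStarAlgebra A] [TopologicalSpace.SeparableSpace A]
    (c : C0Algebra (UnitSpace G) A) (α : GroupoidAction c)
    (I : ClosedIdeal A) (hI : α.IsInvariant I) :
    -- `ρ⋆I`, `ρ⋆A` and `ρ⋆(A/I)` are `C₀(X/H)`-algebras
    IsC0Algebra ((c.ideal I).pullbackΦ H.ρ) ∧
    IsC0Algebra (c.pullbackΦ H.ρ) ∧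
    IsC0Algebra ((c.quot I).pullbackΦ H.ρ) ∧
    -- `ρ⋆ι` and `ρ⋆q` are `C₀(X/H)`-linear
    (∀ φ f, (c.ι I).pullback H.ρ (act ((c.ideal I).pullbackΦ H.ρ) φ f) =
      act (c.pullbackΦ H.ρ) φ ((c.ι I).pullback H.ρ f)) ∧
    (∀ φ f, (c.q I).pullback H.ρ (act (c.pullbackΦ H.ρ) φ f) =
      act ((c.quot I).pullbackΦ H.ρ) φ ((c.q I).pullback H.ρ f)) ∧
    -- the sequence `0 → ρ⋆I → ρ⋆A → ρ⋆(A/I) → 0` is exact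
    Function.Injective ((c.ι I).pullback H.ρ) ∧
    Function.Exact ((c.ι I).pullback H.ρ) ((c.q I).pullback H.ρ) ∧
    Function.Surjective ((c.q I).pullback H.ρ) := by
  have : LocallyCompactSpace H := H.isClosed.isClosedEmbedding_subtypeVal.locallyCompactSpace
  have hr := haarH.isOpenMap_rU
  have : T2Space H.OrbitSpace := ClosedSubgroupoid.t2Space_orbitSpace hr
  have : LocallyCompactSpace H.OrbitSpace := ClosedSubgroupoid.locallyCompactSpace_orbitSpace hr
  refine ⟨isC0Algebra_pullbackΦ _ _, isC0Algebra_pullbackΦ _ _, isC0Algebra_pullbackΦ _ _,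
    fun φ f => ?_, fun φ f => ?_, pullback_ι_injective c H.ρ I, pullback_exact c H.ρ I,
    pullback_surjective H.ρ (c.q I) I.proj_surj⟩
  -- In each fibre the function acts by the scalar `φ y`, so linearity over functions is complex
  -- linearity of the fibre maps.
  · exact c.pullback_ext H.ρ fun y => map_smul ((c.ι I).fiberMap (H.ρ y)) (φ y) (f.1 y)
  · exact (c.quot I).pullback_ext H.ρ fun y => map_smul ((c.q I).fiberMap (H.ρ y)) (φ y) (f.1 y)
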